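/- Theorem. Let $P$ be the closed region bounded by the polygon with the following 26 vertices, in cyclic order: $(0,10)$, $(2,10)$, $(2.5,10.5)$, $(2.5,10)$, $(4,10)$, $(4,\frac{465522}{29357})$, $(6,\frac{312388}{29357})$, $(6,10)$, $(10,10)$, $(10,6)$, $(11.7,6)$, $(12,6.3)$, $(12,\frac{624712}{107175})$, $(\frac{1016072}{101007},4)$, $(10,4)$, $(10,0)$, $(6,0)$, $(6,-\frac{25442}{34407})$, $(4.5,-\frac{138913}{68814})$, $(4.33,-1.37)$, $(4,-1.7)$, $(4,0)$, $(0,0)$, $(0,8)$, $(-0.5,7.5)$, $(0,8.3)$. A set $G\subseteq P$ of points (guards) guards $P$ if for every $p\in P$ there is a $g\in G$ such that the segment $gp$ is contained in $P$; it is optimal if no set with fewer points guards $P$. Then: (a) the polygon is simple, has rational vertices, and is monotone, i.e. there is a line $l$ such that every line orthogonal to $l$ meets the boundary of the polygon at most twice (a part of the boundary that is a segment on the orthogonal line being counted once); (b) $P$ cannot be guarded by one guard, but it can be guarded by two; (c) there is exactly one optimal guard set, and exactly one way of guarding $P$ with two guards, namely $\{l^*,t^*\}$ with $l^*=(3.7-2.2\sqrt2,\;11.7-2.2\sqrt2)$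 and $t^*=(7.4-0.5\sqrt2,\;1.7-0.5\sqrt2)$; (d) all four coordinates of these two guards are irrational; in particular, no two guards with rational coordinates guard $P$. -/

import Mathlib

namespace ArtGallery

/-- The Euclidean plane. -/
abbrev Plane : Type := EuclideanSpace ℝ (Fin 2)

/-- A point of the plane is rational if both of its coordinates are rational numbers. -/
def IsRationalPoint (p : Plane) : Prop :=
  ∀ k : Fin 2, ∃ q : ℚ, p k = (q : ℝ)

/-- A closed polygonal line with at least three edges, all of positive length, is simple if two
consecutive edges share only their common vertex and any other two distinct edges are disjoint.
Here `finRotate n i` is the cyclic successor of `i`, and edge `i` joins vertex `i` to it. -/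
def IsSimple {n : ℕ} (P : Polygon Plane n) : Prop :=
  3 ≤ n ∧ P.HasNondegenerateEdges ∧
    (∀ i : Fin n,
      P.edgeSet ℝ i ∩ P.edgeSet ℝ (finRotate n i) = {P.vertices (finRotate n i)}) ∧
    ∀ i j : Fin n, i ≠ j → j ≠ finRotate n i → i ≠ finRotate n j →
      Disjoint (P.edgeSet ℝ i) (P.edgeSet ℝ j)

/-- A polygon is monotone if, for some line (with direction `d`), every line orthogonal to it meets
the boundary of the polygon at most twice, where an edge (or a chain of edges) that lies on the
orthogonal line counts as one intersection: the intersection with the boundary is the union of at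
most two connected pieces. -/
def IsMonotone {n : ℕ} (P : Polygon Plane n) : Prop :=
  ∃ d : Plane, d ≠ 0 ∧ ∀ c : ℝ, ∃ A B : Set Plane, IsPreconnected A ∧ IsPreconnected B ∧
    P.boundary ℝ ∩ {p : Plane | inner ℝ d p = c} = A ∪ B

/-- The closed region bounded by a polygon: the boundary together with all points that lie in a
bounded connected component of the complement of the boundary. -/
def region {n : ℕ} (P : Polygon Plane n) : Set Plane :=
  P.boundary ℝ ∪
    {p : Plane | p ∉ P.boundary ℝ ∧
      Bornology.IsBounded (connectedComponentIn (P.boundary ℝ)ᶜ p)}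

/-- Two points see each other in `R` if the closed segment between them is contained in `R`. -/
def Sees (R : Set Plane) (p q : Plane) : Prop :=
  segment ℝ p q ⊆ R

/-- `G` guards `R`: the guards lie in `R`, and each point of `R` is seen by some guard. -/
def IsGuardSet (R G : Set Plane) : Prop :=
  G ⊆ R ∧ ∀ p ∈ R, ∃ g ∈ G, Sees R g p

/-- A guard set of minimum cardinality. -/
def IsOptimalGuardSet (R G : Set Plane) : Prop :=
  IsGuardSet R G ∧ ∀ G' : Set Plane, IsGuardSet R G' → G.encard ≤ G'.encard

/-- The (rational) coordinates of the 26 vertices, in cyclic order. -/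
def galleryCoord : Fin 26 → ℚ × ℚ :=
  ![(0, 10),
    (2, 10),
    (5 / 2, 21 / 2),
    (5 / 2, 10),
    (4, 10),
    (4, 465522 / 29357),
    (6, 312388 / 29357),
    (6, 10),
    (10, 10),
    (10, 6),
    (117 / 10, 6),
    (12, 63 / 10),
    (12, 624712 / 107175),
    (1016072 / 101007, 4),
    (10, 4),
    (10, 0),
    (6, 0),
    (6, -25442 / 34407),
    (9 / 2, -138913 / 68814),
    (433 / 100, -137 / 100),
    (4, -17 / 10),
    (4, 0),
    (0, 0),
    (0, 8),
    (-1 / 2, 15 / 2),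
    (0, 83 / 10)]

/-- The polygon with these 26 vertices. -/
noncomputable def gallery : Polygon Plane 26 where
  vertices i := !₂[((galleryCoord i).1 : ℝ), ((galleryCoord i).2 : ℝ)]

/-- The upper left guard. -/
noncomputable def guardL : Plane :=
  !₂[37 / 10 - 11 / 5 * √2, 117 / 10 - 11 / 5 * √2]

/-- The lower right guard. -/
noncomputable def guardT : Plane :=
  !₂[37 / 5 - 1 / 2 * √2, 17 / 10 - 1 / 2 * √2]

end ArtGallery

/-! The region is the square [0,10]² with five pockets. The left and top-left pockets have walls on
y = x + 8, the bottom and right pockets have walls on y = x - 57/10, and each of the four ends in a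
spike. A guard seeing the tip of the left spike lies on or above the first line, one seeing the
top-left tip on or below it, and both have abscissa at most 5/2. The bottom and right tips confine
their guards in the same way to the two sides of the second line, with abscissa at least 4. Hence
two guards must have the form l = (a, a + 8) and t = (b, b - 57/10) (`pair_eq_of_isGuardSet`).

The top, right and bottom pockets each have a long edge that l and t must cover jointly. Each sees
into a pocket only past a corner of its opening, so l covers at most one end portion of the edge and
t at most the other. That the portions meet is a determinant inequality (`det_nonneg_of_forall_or`),
bilinear in a and b. Eliminating b from two of the three inequalities leaves a² - 37/5 a + 401/100 ≤
0, whose roots are 37/10 ± 11/5 √2; the third inequality then forces equality everywhere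
(`eq_of_bilinear_inequalities`).

Conversely, for `guardL` and `guardT` the two limiting sight lines and the long edge are concurrent
in each of the three pockets. The functional of the edge is a positive combination of those of the
sight lines, so a point hidden from both guards would lie beyond the edge.

All visibility arguments use the description of the region by linear inequalities,
`mem_region_gallery`. -/

namespace ArtGallery

/-! ### The region in coordinates -/

/-- The closed region bounded by the gallery in coordinates: the square, followed by the left
pocket, the two top pockets, the bottom pocket and the right pocket. -/
def InGallery (x y : ℝ) : Prop :=
  (0 ≤ x ∧ x ≤ 10 ∧ 0 ≤ y ∧ y ≤ 10) ∨
  (x ≤ 0 ∧ x + 8 ≤ y ∧ y ≤ 8 / 5 * x + 83 / 10) ∨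
  (x ≤ 5 / 2 ∧ 10 ≤ y ∧ y ≤ x + 8) ∨
  (4 ≤ x ∧ x ≤ 6 ∧ 10 ≤ y ∧ y ≤ 465522 / 29357 - 76567 / 29357 * (x - 4)) ∨
  (4 ≤ x ∧ x ≤ 6 ∧ y ≤ 0 ∧ -25442 / 34407 + 9781 / 11469 * (x - 6) ≤ y ∧
    (x - 57 / 10 ≤ y ∨ -137 / 100 - 2231891 / 584919 * (x - 433 / 100) ≤ y)) ∨
  (10 ≤ x ∧ x ≤ 12 ∧ 4 ≤ y ∧ 624712 / 107175 + 33669 / 35725 * (x - 12) ≤ y ∧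
    (y ≤ 6 ∨ y ≤ x - 57 / 10))

/-- Open subsets of the gallery that cover everything but its boundary. -/
def InGalleryInterior (x y : ℝ) : Prop :=
  (0 < x ∧ x < 10 ∧ 0 < y ∧ y < 10) ∨
  (x < 1 ∧ x + 8 < y ∧ y < 8 / 5 * x + 83 / 10) ∨
  (1 / 2 < x ∧ x < 5 / 2 ∧ 0 < y ∧ y < x + 8) ∨
  (4 < x ∧ x < 6 ∧ y < 465522 / 29357 - 76567 / 29357 * (x - 4) ∧
    -25442 / 34407 + 9781 / 11469 * (x - 6) < y ∧
    (x - 57 / 10 < y ∨ -137 / 100 - 2231891 / 584919 * (x - 433 / 100) < y)) ∨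
  (9 < x ∧ x < 12 ∧ 4 < y ∧ 624712 / 107175 + 33669 / 35725 * (x - 12) < y ∧
    (y < 6 ∨ y < x - 57 / 10))

lemma gallery_vertices_zero (i : Fin 26) : gallery.vertices i 0 = ((galleryCoord i).1 : ℝ) := rfl

lemma gallery_vertices_one (i : Fin 26) : gallery.vertices i 1 = ((galleryCoord i).2 : ℝ) := rfl

lemma plane_ext {p q : Plane} (h0 : p 0 = q 0) (h1 : p 1 = q 1) : p = q := by
  ext k
  fin_cases k
  · exact h0
  · exact h1

lemma mem_affineSegment_plane {A B p : Plane} :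
    p ∈ affineSegment ℝ A B ↔
      ∃ t : ℝ, 0 ≤ t ∧ t ≤ 1 ∧ p 0 = A 0 + t * (B 0 - A 0) ∧ p 1 = A 1 + t * (B 1 - A 1) := by
  constructor
  · rintro ⟨t, ⟨h0, h1⟩, rfl⟩
    refine ⟨t, h0, h1, ?_, ?_⟩ <;> simp [AffineMap.lineMap_apply] <;> ring
  · rintro ⟨t, h0, h1, hx, hy⟩
    refine ⟨t, ⟨h0, h1⟩, plane_ext ?_ ?_⟩ <;> simp [AffineMap.lineMap_apply, *] <;> ring

lemma mem_segment_plane {A B p : Plane} :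
    p ∈ segment ℝ A B ↔
      ∃ t : ℝ, 0 ≤ t ∧ t ≤ 1 ∧ p 0 = A 0 + t * (B 0 - A 0) ∧ p 1 = A 1 + t * (B 1 - A 1) := by
  rw [← affineSegment_eq_segment, mem_affineSegment_plane]

lemma mem_edgeSet_gallery {i : Fin 26} {p : Plane} :
    p ∈ gallery.edgeSet ℝ i ↔
      ∃ t : ℝ, 0 ≤ t ∧ t ≤ 1 ∧
        p 0 = (galleryCoord i).1 + t * ((galleryCoord (i + 1)).1 - (galleryCoord i).1) ∧
        p 1 = (galleryCoord i).2 + t * ((galleryCoord (i + 1)).2 - (galleryCoord i).2) := by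
  rw [Polygon.edgeSet, mem_affineSegment_plane, finRotate_apply]
  rfl

lemma mem_boundary_gallery {p : Plane} :
    p ∈ gallery.boundary ℝ ↔
      ∃ i : Fin 26, ∃ t : ℝ, 0 ≤ t ∧ t ≤ 1 ∧
        p 0 = (galleryCoord i).1 + t * ((galleryCoord (i + 1)).1 - (galleryCoord i).1) ∧
        p 1 = (galleryCoord i).2 + t * ((galleryCoord (i + 1)).2 - (galleryCoord i).2) := by
  simp_rw [Polygon.boundary, Set.mem_iUnion, mem_edgeSet_gallery]

/-- A point on the line of a nonvertical edge whose abscissa lies between those of the ends of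
the edge lies on the boundary. -/
lemma mem_boundary_of_line {p : Plane} (i : Fin 26) {a b c d : ℚ} (hi : galleryCoord i = (a, b))
    (hj : galleryCoord (i + 1) = (c, d)) (hac : a ≠ c)
    (hx : 0 ≤ (p 0 - a) * ((c : ℝ) - a)) (hx' : (p 0 - a) * ((c : ℝ) - a) ≤ (c - a) * (c - a))
    (hy : (p 1 - b) * ((c : ℝ) - a) = (p 0 - a) * (d - b)) : p ∈ gallery.boundary ℝ := by
  have h : (c : ℝ) - a ≠ 0 := by
    rw [sub_ne_zero]; exact_mod_cast hac.symm
  have h2 : 0 < ((c : ℝ) - a) * (c - a) := mul_self_pos.2 h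
  refine mem_boundary_gallery.2
    ⟨i, (p 0 - a) * (c - a) / ((c - a) * (c - a)), div_nonneg hx h2.le, (div_le_one h2).2 hx',
      ?_, ?_⟩
  · rw [hi, hj]; field_simp; ring
  · rw [hi, hj]; field_simp; linarith

/-- A point on the line of a vertical edge whose ordinate lies between those of the ends of
the edge lies on the boundary. -/
lemma mem_boundary_of_vertical {p : Plane} (i : Fin 26) {a b d : ℚ}
    (hi : galleryCoord i = (a, b)) (hj : galleryCoord (i + 1) = (a, d)) (hbd : b ≠ d)
    (hx : p 0 = a) (hy : 0 ≤ (p 1 - b) * ((d : ℝ) - b))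
    (hy' : (p 1 - b) * ((d : ℝ) - b) ≤ (d - b) * (d - b)) : p ∈ gallery.boundary ℝ := by
  have h : (d : ℝ) - b ≠ 0 := by
    rw [sub_ne_zero]; exact_mod_cast hbd.symm
  have h2 : 0 < ((d : ℝ) - b) * (d - b) := mul_self_pos.2 h
  refine mem_boundary_gallery.2
    ⟨i, (p 1 - b) * (d - b) / ((d - b) * (d - b)), div_nonneg hy h2.le, (div_le_one h2).2 hy',
      ?_, ?_⟩
  · rw [hi, hj, hx]; simp
  · rw [hi, hj]; field_simp; ring

lemma inGallery_of_mem_boundary {p : Plane} (hp : p ∈ gallery.boundary ℝ) :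
    InGallery (p 0) (p 1) := by
  obtain ⟨i, t, h0, h1, hx, hy⟩ := mem_boundary_gallery.1 hp
  obtain ⟨⟨a, b⟩, hi⟩ : ∃ v, v = galleryCoord i := ⟨_, rfl⟩
  obtain ⟨⟨c, d⟩, hj⟩ : ∃ v, v = galleryCoord (i + 1) := ⟨_, rfl⟩
  rw [← hi, ← hj] at hx hy
  generalize p 0 = x at *
  generalize p 1 = y at *
  clear hp
  fin_cases i <;> replace hi : _ = (_, _) := hi <;> replace hj : _ = (_, _) := hj <;>
    obtain ⟨rfl, rfl⟩ := Prod.mk.inj hi <;> obtain ⟨rfl, rfl⟩ := Prod.mk.inj hj <;>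
    clear hi hj <;> norm_num at hx hy
  -- Each edge lies in a single piece, and satisfies a single alternative of a disjunctive piece
  -- along its whole length, so no case split on t is needed.
  all_goals first
    | refine Or.inl ⟨?_, ?_, ?_, ?_⟩ <;> linarith
    | refine Or.inr (Or.inl ⟨?_, ?_, ?_⟩) <;> linarith
    | refine Or.inr (Or.inr (Or.inl ⟨?_, ?_, ?_⟩)) <;> linarith
    | refine Or.inr (Or.inr (Or.inr (Or.inl ⟨?_, ?_, ?_, ?_⟩))) <;> linarith
    | refine Or.inr (Or.inr (Or.inr (Or.inr (Or.inl ⟨?_, ?_, ?_, ?_, Or.inl ?_⟩)))) <;> linarith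
    | refine Or.inr (Or.inr (Or.inr (Or.inr (Or.inl ⟨?_, ?_, ?_, ?_, Or.inr ?_⟩)))) <;> linarith
    | refine Or.inr (Or.inr (Or.inr (Or.inr (Or.inr ⟨?_, ?_, ?_, ?_, Or.inl ?_⟩)))) <;> linarith
    | refine Or.inr (Or.inr (Or.inr (Or.inr (Or.inr ⟨?_, ?_, ?_, ?_, Or.inr ?_⟩)))) <;> linarith

lemma InGalleryInterior.inGallery {x y : ℝ} (h : InGalleryInterior x y) : InGallery x y := by
  rcases h with ⟨h1, h2, h3, h4⟩ | ⟨h1, h2, h3⟩ | ⟨h1, h2, h3, h4⟩ | ⟨h1, h2, h3, h4, h5⟩ |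
    ⟨h1, h2, h3, h4, h5⟩
  · exact Or.inl ⟨h1.le, h2.le, h3.le, h4.le⟩
  · rcases le_total x 0 with h | h
    · exact Or.inr (Or.inl ⟨h, h2.le, h3.le⟩)
    · refine Or.inl ⟨?_, ?_, ?_, ?_⟩ <;> linarith
  · rcases le_total 10 y with h | h
    · exact Or.inr (Or.inr (Or.inl ⟨h2.le, h, h4.le⟩))
    · refine Or.inl ⟨?_, ?_, ?_, ?_⟩ <;> linarith
  · rcases le_total 10 y with h | h
    · exact Or.inr (Or.inr (Or.inr (Or.inl ⟨h1.le, h2.le, h, h3.le⟩)))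
    rcases le_total 0 y with h' | h'
    · refine Or.inl ⟨?_, ?_, ?_, ?_⟩ <;> linarith
    · exact Or.inr (Or.inr (Or.inr (Or.inr (Or.inl
        ⟨h1.le, h2.le, h', h4.le, h5.imp le_of_lt le_of_lt⟩))))
  · rcases le_total 10 x with h | h
    · exact Or.inr (Or.inr (Or.inr (Or.inr (Or.inr
        ⟨h, h2.le, h3.le, h4.le, h5.imp le_of_lt le_of_lt⟩))))
    · rcases h5 with h5 | h5 <;> refine Or.inl ⟨?_, ?_, ?_, ?_⟩ <;> linarith

/-- The gallery is vertically convex. -/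
lemma InGallery.of_le_of_le {x y y₁ y₂ : ℝ} (h₁ : InGallery x y₁) (h₂ : InGallery x y₂)
    (hy₁ : y₁ ≤ y) (hy₂ : y ≤ y₂) : InGallery x y := by
  rcases lt_or_ge x 0 with hx | hx
  · have h1 : x + 8 ≤ y₁ := by unfold InGallery at h₁; grind
    have h2 : y₂ ≤ 8 / 5 * x + 83 / 10 := by unfold InGallery at h₂; grind
    exact Or.inr (Or.inl ⟨hx.le, by linarith, by linarith⟩)
  rcases lt_or_ge 10 x with hx' | hx'
  · have h1 : x ≤ 12 ∧ 4 ≤ y₁ ∧ 624712 / 107175 + 33669 / 35725 * (x - 12) ≤ y₁ := by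
      unfold InGallery at h₁; grind
    have h2 : y₂ ≤ 6 ∨ y₂ ≤ x - 57 / 10 := by unfold InGallery at h₂; grind
    exact Or.inr (Or.inr (Or.inr (Or.inr (Or.inr ⟨hx'.le, h1.1, by linarith, by linarith,
      h2.imp (by intro; linarith) (by intro; linarith)⟩))))
  -- Over 0 ≤ x ≤ 10 the square supplies all heights from 0 to 10; above 10 only the upper point
  -- matters, below 0 only the lower one.
  rcases lt_or_ge 10 y with hy | hy
  · unfold InGallery at h₂ ⊢; clear h₁; grind
  rcases lt_or_ge y 0 with hy' | hy'
  · unfold InGallery at h₁ ⊢; clear h₂; grind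
  exact Or.inl ⟨hx, hx', hy', hy⟩

lemma mem_boundary_or_interior_of_square {p : Plane}
    (h : 0 ≤ p 0 ∧ p 0 ≤ 10 ∧ 0 ≤ p 1 ∧ p 1 ≤ 10) :
    p ∈ gallery.boundary ℝ ∨ InGalleryInterior (p 0) (p 1) := by
  obtain ⟨h1, h2, h3, h4⟩ := h
  rcases h1.eq_or_lt with hx | hx
  · rcases le_or_gt (p 1) 8 with hy | hy
    · left
      refine mem_boundary_of_vertical 22 rfl rfl (by norm_num) ?_ ?_ ?_ <;> push_cast <;> linarith
    rcases le_or_gt (83 / 10) (p 1) with hy' | hy'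
    · left
      refine mem_boundary_of_vertical 25 rfl rfl (by norm_num) ?_ ?_ ?_ <;> push_cast <;> linarith
    · right; refine Or.inr (Or.inl ⟨?_, ?_, ?_⟩) <;> linarith
  rcases h2.eq_or_lt with hx' | hx'
  · rcases le_or_gt (p 1) 4 with hy | hy
    · left
      refine mem_boundary_of_vertical 14 rfl rfl (by norm_num) ?_ ?_ ?_ <;> push_cast <;> linarith
    rcases le_or_gt 6 (p 1) with hy' | hy'
    · left
      refine mem_boundary_of_vertical 8 rfl rfl (by norm_num) ?_ ?_ ?_ <;> push_cast <;> linarith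
    · right
      refine Or.inr (Or.inr (Or.inr (Or.inr ⟨?_, ?_, ?_, ?_, Or.inl ?_⟩))) <;> linarith
  rcases h3.eq_or_lt with hy | hy
  · rcases le_or_gt (p 0) 4 with h | h
    · left
      refine mem_boundary_of_line 21 rfl rfl (by norm_num) ?_ ?_ ?_ <;> push_cast <;> linarith
    rcases le_or_gt 6 (p 0) with h' | h'
    · left
      refine mem_boundary_of_line 15 rfl rfl (by norm_num) ?_ ?_ ?_ <;> push_cast <;> linarith
    · right
      refine Or.inr (Or.inr (Or.inr (Or.inl ⟨?_, ?_, ?_, ?_, ?_⟩))) <;> try linarith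
      rcases lt_or_ge (p 0) 5 with h5 | h5
      · left; linarith
      · right; linarith
  rcases h4.eq_or_lt with hy' | hy'
  · rcases le_or_gt (p 0) 2 with h | h
    · left
      refine mem_boundary_of_line 0 rfl rfl (by norm_num) ?_ ?_ ?_ <;> push_cast <;> linarith
    rcases lt_or_ge (p 0) (5 / 2) with h' | h'
    · right; refine Or.inr (Or.inr (Or.inl ⟨?_, ?_, ?_, ?_⟩)) <;> linarith
    rcases le_or_gt (p 0) 4 with h | h
    · left
      refine mem_boundary_of_line 3 rfl rfl (by norm_num) ?_ ?_ ?_ <;> push_cast <;> linarith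
    rcases le_or_gt 6 (p 0) with h' | h'
    · left
      refine mem_boundary_of_line 7 rfl rfl (by norm_num) ?_ ?_ ?_ <;> push_cast <;> linarith
    · right
      refine Or.inr (Or.inr (Or.inr (Or.inl ⟨?_, ?_, ?_, ?_, Or.inl ?_⟩))) <;> linarith
  · exact Or.inr (Or.inl ⟨hx, hx', hy, hy'⟩)

lemma mem_boundary_or_interior_of_bottom {p : Plane}
    (h : 4 ≤ p 0 ∧ p 0 ≤ 6 ∧ p 1 ≤ 0 ∧ -25442 / 34407 + 9781 / 11469 * (p 0 - 6) ≤ p 1 ∧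
    (p 0 - 57 / 10 ≤ p 1 ∨ -137 / 100 - 2231891 / 584919 * (p 0 - 433 / 100) ≤ p 1)) :
    p ∈ gallery.boundary ℝ ∨ InGalleryInterior (p 0) (p 1) := by
  obtain ⟨h1, h2, h3, h4, h5⟩ := h
  rcases h1.eq_or_lt with hx | hx
  · left
    have : -17 / 10 ≤ p 1 := by rcases h5 with h5 | h5 <;> linarith
    refine mem_boundary_of_vertical 20 rfl rfl (by norm_num) ?_ ?_ ?_ <;> push_cast <;> linarith
  rcases h2.eq_or_lt with hx' | hx'
  · left
    refine mem_boundary_of_vertical 16 rfl rfl (by norm_num) ?_ ?_ ?_ <;> push_cast <;> linarith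
  rcases h4.eq_or_lt with hy | hy
  · left
    have : 9 / 2 ≤ p 0 := by rcases h5 with h5 | h5 <;> linarith
    refine mem_boundary_of_line 17 rfl rfl (by norm_num) ?_ ?_ ?_ <;> push_cast <;> linarith
  by_cases h6 : p 0 - 57 / 10 < p 1 ∨ -137 / 100 - 2231891 / 584919 * (p 0 - 433 / 100) < p 1
  · right
    refine Or.inr (Or.inr (Or.inr (Or.inl ⟨hx, hx', ?_, hy, h6⟩)))
    linarith
  · left
    push Not at h6
    rcases h5 with h5 | h5
    · refine mem_boundary_of_line 19 rfl rfl (by norm_num) ?_ ?_ ?_ <;> push_cast <;> linarith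
    · refine mem_boundary_of_line 18 rfl rfl (by norm_num) ?_ ?_ ?_ <;> push_cast <;> linarith

lemma mem_boundary_or_interior_of_right {p : Plane}
    (h : 10 ≤ p 0 ∧ p 0 ≤ 12 ∧ 4 ≤ p 1 ∧ 624712 / 107175 + 33669 / 35725 * (p 0 - 12) ≤ p 1 ∧
    (p 1 ≤ 6 ∨ p 1 ≤ p 0 - 57 / 10)) :
    p ∈ gallery.boundary ℝ ∨ InGalleryInterior (p 0) (p 1) := by
  obtain ⟨h1, h2, h3, h4, h5⟩ := h
  rcases h2.eq_or_lt with hx | hx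
  · left
    have : p 1 ≤ 63 / 10 := by rcases h5 with h5 | h5 <;> linarith
    refine mem_boundary_of_vertical 11 rfl rfl (by norm_num) ?_ ?_ ?_ <;> push_cast <;> linarith
  rcases h3.eq_or_lt with hy | hy
  · left
    refine mem_boundary_of_line 13 rfl rfl (by norm_num) ?_ ?_ ?_ <;> push_cast <;> linarith
  rcases h4.eq_or_lt with hy' | hy'
  · left
    refine mem_boundary_of_line 12 rfl rfl (by norm_num) ?_ ?_ ?_ <;> push_cast <;> linarith
  by_cases h6 : p 1 < 6 ∨ p 1 < p 0 - 57 / 10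
  · right
    refine Or.inr (Or.inr (Or.inr (Or.inr ⟨?_, hx, hy, hy', h6⟩)))
    linarith
  · left
    push Not at h6
    rcases h5 with h5 | h5
    · refine mem_boundary_of_line 9 rfl rfl (by norm_num) ?_ ?_ ?_ <;> push_cast <;> linarith
    · refine mem_boundary_of_line 10 rfl rfl (by norm_num) ?_ ?_ ?_ <;> push_cast <;> linarith

/-- The open pieces overlap across the openings between square and pockets, so only genuine walls
are left to the boundary. -/
lemma mem_boundary_or_interior {p : Plane} (h : InGallery (p 0) (p 1)) :
    p ∈ gallery.boundary ℝ ∨ InGalleryInterior (p 0) (p 1) := by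
  rcases h with h | ⟨h1, h2, h3⟩ | ⟨h1, h2, h3⟩ | ⟨h1, h2, h3, h4⟩ | h | h
  · exact mem_boundary_or_interior_of_square h
  · rcases h2.eq_or_lt with h | h
    · left
      refine mem_boundary_of_line 23 rfl rfl (by norm_num) ?_ ?_ ?_ <;> push_cast <;> linarith
    rcases h3.eq_or_lt with h' | h'
    · left
      refine mem_boundary_of_line 24 rfl rfl (by norm_num) ?_ ?_ ?_ <;> push_cast <;> linarith
    · right; refine Or.inr (Or.inl ⟨?_, ?_, ?_⟩) <;> linarith
  · rcases h1.eq_or_lt with h | h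
    · left
      refine mem_boundary_of_vertical 2 rfl rfl (by norm_num) ?_ ?_ ?_ <;> push_cast <;> linarith
    rcases h3.eq_or_lt with h' | h'
    · left
      refine mem_boundary_of_line 1 rfl rfl (by norm_num) ?_ ?_ ?_ <;> push_cast <;> linarith
    · right; refine Or.inr (Or.inr (Or.inl ⟨?_, ?_, ?_, ?_⟩)) <;> linarith
  · rcases h1.eq_or_lt with h | h
    · left
      refine mem_boundary_of_vertical 4 rfl rfl (by norm_num) ?_ ?_ ?_ <;> push_cast <;> linarith
    rcases h2.eq_or_lt with h' | h'
    · left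
      refine mem_boundary_of_vertical 6 rfl rfl (by norm_num) ?_ ?_ ?_ <;> push_cast <;> linarith
    rcases h4.eq_or_lt with hy | hy
    · left
      refine mem_boundary_of_line 5 rfl rfl (by norm_num) ?_ ?_ ?_ <;> push_cast <;> linarith
    · right
      refine Or.inr (Or.inr (Or.inr (Or.inl ⟨?_, ?_, ?_, ?_, Or.inl ?_⟩))) <;> linarith
  · exact mem_boundary_or_interior_of_bottom h
  · exact mem_boundary_or_interior_of_right h

lemma isOpen_galleryInterior : IsOpen {p : Plane | InGalleryInterior (p 0) (p 1)} := by
  unfold InGalleryInterior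
  simp only [Set.ofPred_or, Set.ofPred_and]
  repeat' first
    | apply IsOpen.union
    | apply IsOpen.inter
    | (apply isOpen_lt <;> fun_prop)

lemma isClosed_gallery : IsClosed {p : Plane | InGallery (p 0) (p 1)} := by
  unfold InGallery
  simp only [Set.ofPred_or, Set.ofPred_and]
  repeat' first
    | apply IsClosed.union
    | apply IsClosed.inter
    | (apply isClosed_le <;> fun_prop)

lemma InGallery.bounds {x y : ℝ} (h : InGallery x y) :
    -1 / 2 ≤ x ∧ x ≤ 12 ∧ -3 ≤ y ∧ y ≤ 16 := by
  rcases h with ⟨h1, h2, h3, h4⟩ | ⟨h1, h2, h3⟩ | ⟨h1, h2, h3⟩ | ⟨h1, h2, h3, h4⟩ |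
    ⟨h1, h2, h3, h4, h5⟩ | ⟨h1, h2, h3, h4, h5 | h5⟩ <;>
  refine ⟨?_, ?_, ?_, ?_⟩ <;> linarith

lemma isBounded_gallery : Bornology.IsBounded {p : Plane | InGallery (p 0) (p 1)} := by
  rw [isBounded_iff_forall_norm_le]
  refine ⟨30, fun p hp => ?_⟩
  obtain ⟨h1, h2, h3, h4⟩ := InGallery.bounds hp
  rw [EuclideanSpace.norm_eq, Fin.sum_univ_two, Real.sqrt_le_left (by norm_num)]
  simp only [Real.norm_eq_abs, sq_abs]
  nlinarith

/-- A vertical ray that misses the gallery is a connected unbounded set in the complement of the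
boundary. -/
lemma not_isBounded_component_of_forall {p : Plane} (s : ℝ) (hs : s ≠ 0)
    (h : ∀ t : ℝ, 0 ≤ t → ¬ InGallery (p 0) (p 1 + t * s)) :
    ¬ Bornology.IsBounded (connectedComponentIn (gallery.boundary ℝ)ᶜ p) := by
  intro hb
  let f : ℝ → Plane := fun t => !₂[p 0, p 1 + t * s]
  have hf : Continuous f := by
    refine (PiLp.continuous_toLp 2 _).comp (continuous_pi fun k => ?_)
    fin_cases k
    · exact continuous_const
    · exact continuous_const.add (continuous_id.mul continuous_const)
  have hpre : IsPreconnected (f '' Set.Ici 0) := isPreconnected_Ici.image f hf.continuousOn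
  have hp : p ∈ f '' Set.Ici 0 := ⟨0, Set.mem_Ici.2 le_rfl, plane_ext rfl (by simp [f])⟩
  have hsub : f '' Set.Ici 0 ⊆ (gallery.boundary ℝ)ᶜ := by
    rintro _ ⟨t, ht, rfl⟩ hmem
    exact h t ht (inGallery_of_mem_boundary hmem)
  have hb' := hb.subset (hpre.subset_connectedComponentIn hp hsub)
  obtain ⟨C, hC⟩ := isBounded_iff_forall_norm_le.1 hb'
  have hC0 : 0 ≤ C := (norm_nonneg _).trans (hC p hp)
  have h1 := hC (f ((C + 1 + |p 1|) / |s|)) ⟨_, Set.mem_Ici.2 (by positivity), rfl⟩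
  have h2 := (PiLp.norm_apply_le (f ((C + 1 + |p 1|) / |s|)) 1).trans h1
  have h3 : |(C + 1 + |p 1|) / |s| * s| = C + 1 + |p 1| := by
    rw [abs_mul, abs_div, abs_abs, div_mul_cancel₀ _ (abs_ne_zero.2 hs), abs_of_nonneg]
    positivity
  have h4 : |p 1 + (C + 1 + |p 1|) / |s| * s| ≤ C := h2
  have h5 := abs_sub_abs_le_abs_sub ((C + 1 + |p 1|) / |s| * s) (-p 1)
  rw [abs_neg, sub_neg_eq_add, add_comm _ (p 1), h3] at h5
  linarith

/-- By vertical convexity, a point outside the gallery has a free vertical ray upwards or downwards.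
Conversely, the open pieces and the exterior are disjoint open sets covering the complement of the
boundary, so a component starting in the former stays in the bounded gallery. -/
theorem mem_region_gallery {p : Plane} : p ∈ region gallery ↔ InGallery (p 0) (p 1) := by
  constructor
  · rintro (h | ⟨-, h⟩)
    · exact inGallery_of_mem_boundary h
    by_contra hp
    by_cases h1 : ∃ t : ℝ, 0 ≤ t ∧ InGallery (p 0) (p 1 + t * 1)
    · by_cases h2 : ∃ t : ℝ, 0 ≤ t ∧ InGallery (p 0) (p 1 + t * -1)
      · obtain ⟨t, ht, h1⟩ := h1
        obtain ⟨u, hu, h2⟩ := h2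
        exact hp (h2.of_le_of_le h1 (by linarith) (by linarith))
      · push Not at h2
        exact not_isBounded_component_of_forall (-1) (by norm_num) h2 h
    · push Not at h1
      exact not_isBounded_component_of_forall 1 (by norm_num) h1 h
  · intro h
    by_cases hb : p ∈ gallery.boundary ℝ
    · exact Or.inl hb
    refine Or.inr ⟨hb, isBounded_gallery.subset ?_⟩
    refine Set.Subset.trans ?_ (fun q (hq : InGalleryInterior (q 0) (q 1)) => hq.inGallery)
    refine isPreconnected_connectedComponentIn.subset_left_of_subset_union
      isOpen_galleryInterior isClosed_gallery.isOpen_compl ?_ ?_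
      ⟨p, mem_connectedComponentIn hb, (mem_boundary_or_interior h).resolve_left hb⟩
    · exact Set.disjoint_left.2 fun q hq hq' => hq' (InGalleryInterior.inGallery hq)
    · intro q hq
      by_cases hq' : InGallery (q 0) (q 1)
      · exact Or.inl ((mem_boundary_or_interior hq').resolve_left
          (connectedComponentIn_subset _ _ hq))
      · exact Or.inr hq'

/-! ### Simplicity -/

lemma disjoint_affineSegment_of_lt {A B C D : Plane} (a b : ℝ)
    (h₁ : a * A 0 + b * A 1 < a * C 0 + b * C 1) (h₂ : a * A 0 + b * A 1 < a * D 0 + b * D 1)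
    (h₃ : a * B 0 + b * B 1 < a * C 0 + b * C 1) (h₄ : a * B 0 + b * B 1 < a * D 0 + b * D 1) :
    Disjoint (affineSegment ℝ A B) (affineSegment ℝ C D) := by
  rw [Set.disjoint_left]
  intro p hp hq
  obtain ⟨s, hs0, hs1, hx, hy⟩ := mem_affineSegment_plane.1 hp
  obtain ⟨t, ht0, ht1, hx', hy'⟩ := mem_affineSegment_plane.1 hq
  obtain ⟨u, hu⟩ : ∃ u, u = a * p 0 + b * p 1 := ⟨_, rfl⟩
  have e1 : u = (1 - s) * (a * A 0 + b * A 1) + s * (a * B 0 + b * B 1) := by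
    rw [hu, hx, hy]; ring
  have e2 : u = (1 - t) * (a * C 0 + b * C 1) + t * (a * D 0 + b * D 1) := by
    rw [hu, hx', hy']; ring
  generalize a * A 0 + b * A 1 = α at *
  generalize a * B 0 + b * B 1 = β at *
  generalize a * C 0 + b * C 1 = γ at *
  generalize a * D 0 + b * D 1 = δ at *
  have k1 : u ≤ max α β := by
    nlinarith [le_max_left α β, le_max_right α β]
  have k2 : min γ δ ≤ u := by
    nlinarith [min_le_left γ δ, min_le_right γ δ]
  have k3 : max α β < min γ δ := max_lt (lt_min h₁ h₂) (lt_min h₃ h₄)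
  linarith

lemma affineSegment_inter_of_cross_ne_zero {A B C : Plane}
    (h : (A 0 - B 0) * (C 1 - B 1) - (A 1 - B 1) * (C 0 - B 0) ≠ 0) :
    affineSegment ℝ A B ∩ affineSegment ℝ B C = {B} := by
  ext p
  simp only [Set.mem_inter_iff, Set.mem_singleton_iff]
  constructor
  · rintro ⟨hp, hq⟩
    obtain ⟨s, hs0, hs1, hx, hy⟩ := mem_affineSegment_plane.1 hp
    obtain ⟨t, ht0, ht1, hx', hy'⟩ := mem_affineSegment_plane.1 hq
    -- Crossing both expressions for p - B with A - B eliminates s.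
    have ht : t * ((A 0 - B 0) * (C 1 - B 1) - (A 1 - B 1) * (C 0 - B 0)) = 0 := by
      linear_combination (A 0 - B 0) * (hy - hy') - (A 1 - B 1) * (hx - hx')
    rcases mul_eq_zero.1 ht with ht | ht
    · subst ht
      exact plane_ext (by linarith) (by linarith)
    · exact absurd ht h
  · rintro rfl
    exact ⟨right_mem_affineSegment ℝ _ _, left_mem_affineSegment ℝ _ _⟩

/-- The linear functional with coefficients `f` takes smaller values on the segment from `A` to `B`
than on the segment from `C` to `D`. -/
def Separates (f A B C D : ℚ × ℚ) : Prop :=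
  f.1 * A.1 + f.2 * A.2 < f.1 * C.1 + f.2 * C.2 ∧ f.1 * A.1 + f.2 * A.2 < f.1 * D.1 + f.2 * D.2 ∧
  f.1 * B.1 + f.2 * B.2 < f.1 * C.1 + f.2 * C.2 ∧ f.1 * B.1 + f.2 * B.2 < f.1 * D.1 + f.2 * D.2

instance (f A B C D : ℚ × ℚ) : Decidable (Separates f A B C D) := by
  unfold Separates; infer_instance

/-- Normals of the two segments and the coordinate functionals, up to sign. -/
def separatingCandidates (A B C D : ℚ × ℚ) : List (ℚ × ℚ) :=
  [(1, 0), (-1, 0), (0, 1), (0, -1), (B.2 - A.2, A.1 - B.1), (A.2 - B.2, B.1 - A.1),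
    (D.2 - C.2, C.1 - D.1), (C.2 - D.2, D.1 - C.1)]

/-- Searching eight candidate functionals makes the existence of a separating line a finite
computation over ℚ. -/
lemma galleryCoord_separated : ∀ i j : Fin 26, i ≠ j → j ≠ i + 1 → i ≠ j + 1 →
    ∃ f ∈ separatingCandidates (galleryCoord i) (galleryCoord (i + 1)) (galleryCoord j)
      (galleryCoord (j + 1)), Separates f (galleryCoord i) (galleryCoord (i + 1)) (galleryCoord j)
      (galleryCoord (j + 1)) := by
  decide +kernel

lemma galleryCoord_cross_ne_zero : ∀ i : Fin 26,
    ((galleryCoord i).1 - (galleryCoord (i + 1)).1) *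
      ((galleryCoord (i + 1 + 1)).2 - (galleryCoord (i + 1)).2) -
    ((galleryCoord i).2 - (galleryCoord (i + 1)).2) *
      ((galleryCoord (i + 1 + 1)).1 - (galleryCoord (i + 1)).1) ≠ 0 := by
  decide +kernel

theorem isSimple_gallery : IsSimple gallery := by
  refine ⟨by norm_num, fun i h => ?_, fun i => ?_, fun i j hij hj hi => ?_⟩
  · rw [finRotate_apply] at h
    apply galleryCoord_cross_ne_zero i
    have h0 : (galleryCoord i).1 = (galleryCoord (i + 1)).1 := by
      have := congrArg (fun p : Plane => p 0) h
      exact Rat.cast_injective (α := ℝ) this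
    have h1 : (galleryCoord i).2 = (galleryCoord (i + 1)).2 := by
      have := congrArg (fun p : Plane => p 1) h
      exact Rat.cast_injective (α := ℝ) this
    rw [h0, h1]; ring
  · simp only [Polygon.edgeSet, finRotate_apply]
    apply affineSegment_inter_of_cross_ne_zero
    simp only [gallery_vertices_zero, gallery_vertices_one]
    exact_mod_cast galleryCoord_cross_ne_zero i
  · rw [finRotate_apply] at hj hi
    obtain ⟨f, -, h1, h2, h3, h4⟩ := galleryCoord_separated i j hij hj hi
    simp only [Polygon.edgeSet, finRotate_apply]
    apply disjoint_affineSegment_of_lt (f.1 : ℝ) (f.2 : ℝ) <;>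
    simp only [gallery_vertices_zero, gallery_vertices_one]
    · exact_mod_cast h1
    · exact_mod_cast h2
    · exact_mod_cast h3
    · exact_mod_cast h4

/-! ### Monotonicity -/

/-- The polygonal path through the given points. -/
def polyline : List Plane → Set Plane
  | A :: B :: l => affineSegment ℝ A B ∪ polyline (B :: l)
  | _ => ∅

lemma le_of_mem_polyline {A : Plane} {l : List Plane}
    (h : (A :: l).IsChain (fun p q : Plane => p 0 ≤ q 0)) {p : Plane} (hp : p ∈ polyline (A :: l)) :
    A 0 ≤ p 0 := by
  induction l generalizing A with
  | nil => exact hp.elim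
  | cons B l ih =>
    rw [List.isChain_cons_cons] at h
    rcases hp with hp | hp
    · obtain ⟨t, h0, h1, hx, -⟩ := mem_affineSegment_plane.1 hp
      rw [hx]
      nlinarith [mul_nonneg h0 (sub_nonneg.2 h.1)]
    · exact h.1.trans (ih h.2 hp)

lemma isPreconnected_segment_inter_vertical (A B : Plane) (c : ℝ) :
    IsPreconnected (affineSegment ℝ A B ∩ {p : Plane | p 0 = c}) := by
  apply Convex.isPreconnected
  rw [affineSegment_eq_segment]
  refine (convex_segment A B).inter ?_
  intro p hp q hq a b _ _ hab
  simp only [Set.mem_ofPred_eq] at hp hq ⊢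
  simp [hp, hq, ← add_mul, hab]

/-- A path with weakly increasing abscissas meets every vertical line in a connected set. -/
lemma isPreconnected_polyline_inter_vertical {l : List Plane}
    (h : l.IsChain (fun p q : Plane => p 0 ≤ q 0)) (c : ℝ) :
    IsPreconnected (polyline l ∩ {p : Plane | p 0 = c}) := by
  induction l with
  | nil => simpa [polyline] using isPreconnected_empty
  | cons A l ih =>
    cases l with
    | nil => simpa [polyline] using isPreconnected_empty
    | cons B l =>
      have h' := List.isChain_cons_cons.1 h
      have ih := ih h'.2
      have hs := isPreconnected_segment_inter_vertical A B c
      rw [polyline, Set.union_inter_distrib_right]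
      rcases Set.eq_empty_or_nonempty (affineSegment ℝ A B ∩ {p : Plane | p 0 = c}) with
        he | ⟨p, hp, hpc⟩
      · rwa [he, Set.empty_union]
      rcases Set.eq_empty_or_nonempty (polyline (B :: l) ∩ {p : Plane | p 0 = c}) with
        he | ⟨q, hq, hqc⟩
      · rwa [he, Set.union_empty]
      simp only [Set.mem_ofPred_eq] at hpc hqc
      -- If the first segment and the remaining path both meet the line, then c is squeezed to the
      -- abscissa of B, and B joins the two connected pieces.
      have h1 : B 0 ≤ c := hqc ▸ le_of_mem_polyline h'.2 hq
      obtain ⟨t, ht0, ht1, hx, -⟩ := mem_affineSegment_plane.1 hp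
      have h2 : c ≤ B 0 := by
        rw [← hpc, hx]
        nlinarith [mul_nonneg (sub_nonneg.2 ht1) (sub_nonneg.2 h'.1)]
      have hB : B 0 = c := le_antisymm h1 h2
      refine hs.union B ⟨right_mem_affineSegment ℝ _ _, hB⟩ ⟨?_, hB⟩ ih
      cases l with
      | nil => exact hq.elim
      | cons C l => exact Or.inl (left_mem_affineSegment ℝ _ _)

/-- This turns the comparison of the boundary with the two chains into a decidable question about
lists of indices. -/
lemma mem_polyline_map {ι : Type*} {v : ι → Plane} {l : List ι} {p : Plane} :
    p ∈ polyline (l.map v) ↔ ∃ i j, [i, j] <:+: l ∧ p ∈ affineSegment ℝ (v i) (v j) := by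
  induction l with
  | nil => simp [polyline]
  | cons a l ih =>
    cases l with
    | nil =>
      simp only [List.map_cons, List.map_nil, polyline, Set.mem_empty_iff_false, false_iff]
      rintro ⟨i, j, h, -⟩
      simpa using h.length_le
    | cons b l =>
      simp only [List.map_cons] at ih ⊢
      rw [polyline, Set.mem_union, ih]
      constructor
      · rintro (h | ⟨i, j, h, h'⟩)
        · exact ⟨a, b, ⟨[], l, by simp⟩, h⟩
        · exact ⟨i, j, List.infix_cons h, h'⟩
      · rintro ⟨i, j, h, h'⟩
        rcases List.infix_cons_iff.1 h with h | h
        · simp only [List.cons_prefix_cons, List.nil_prefix, and_true] at h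
          obtain ⟨rfl, rfl⟩ := h
          exact Or.inl h'
        · exact Or.inr ⟨i, j, h, h'⟩

/-- Indices of the vertices of the upper chain, from left to right. -/
def upperChain : List (Fin 26) := [24, 25, 0, 1, 2, 3, 4, 5, 6, 7, 8, 9, 10, 11, 12]

/-- Indices of the vertices of the lower chain, from left to right. -/
def lowerChain : List (Fin 26) := [24, 23, 22, 21, 20, 19, 18, 17, 16, 15, 14, 13, 12]

lemma boundary_gallery_eq : gallery.boundary ℝ =
    polyline (upperChain.map gallery.vertices) ∪ polyline (lowerChain.map gallery.vertices) := by
  have h1 : ∀ i : Fin 26, [i, i + 1] <:+: upperChain ∨ [i + 1, i] <:+: lowerChain := by decide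
  have h2 : ∀ i j : Fin 26, [i, j] <:+: upperChain → j = i + 1 := by decide +kernel
  have h3 : ∀ i j : Fin 26, [i, j] <:+: lowerChain → i = j + 1 := by decide +kernel
  ext p
  simp only [Polygon.boundary, Set.mem_iUnion, Polygon.edgeSet, finRotate_apply, Set.mem_union,
    mem_polyline_map]
  constructor
  · rintro ⟨i, hi⟩
    rcases h1 i with h | h
    · exact Or.inl ⟨_, _, h, hi⟩
    · exact Or.inr ⟨_, _, h, by rwa [affineSegment_comm]⟩
  · rintro (⟨i, j, h, hp⟩ | ⟨i, j, h, hp⟩)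
    · obtain rfl := h2 i j h
      exact ⟨i, hp⟩
    · obtain rfl := h3 i j h
      exact ⟨j, by rwa [affineSegment_comm]⟩

lemma isChain_map_vertices {l : List (Fin 26)}
    (h : l.IsChain (fun i j => (galleryCoord i).1 ≤ (galleryCoord j).1)) :
    (l.map gallery.vertices).IsChain (fun p q : Plane => p 0 ≤ q 0) := by
  rw [List.isChain_map]
  refine h.imp fun i j hij => ?_
  rw [gallery_vertices_zero, gallery_vertices_zero]
  exact Rat.cast_le.2 hij

theorem isMonotone_gallery : IsMonotone gallery := by
  refine ⟨!₂[1, 0], fun h => ?_, fun c => ⟨_, _,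
    isPreconnected_polyline_inter_vertical (isChain_map_vertices (l := upperChain) ?_) c,
    isPreconnected_polyline_inter_vertical (isChain_map_vertices (l := lowerChain) ?_) c, ?_⟩⟩
  · have := congrArg (fun p : Plane => p 0) h
    simp at this
  · decide +kernel
  · decide +kernel
  · rw [boundary_gallery_eq, Set.union_inter_distrib_right]
    have : {p : Plane | inner ℝ !₂[(1 : ℝ), 0] p = c} = {p : Plane | p 0 = c} := by
      ext p
      simp [PiLp.inner_apply, Fin.sum_univ_two]
    rw [this]

/-! ### Two guards suffice -/

/-- An intersection of half-planes is convex; visibility reduces to exhibiting one inside the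
gallery that contains both points. -/
lemma sees_of_halfplanes {p q : Plane} (H : List (ℝ × ℝ × ℝ))
    (hH : ∀ x y : ℝ, (∀ h ∈ H, h.1 * x + h.2.1 * y ≤ h.2.2) → InGallery x y)
    (hp : ∀ h ∈ H, h.1 * p 0 + h.2.1 * p 1 ≤ h.2.2)
    (hq : ∀ h ∈ H, h.1 * q 0 + h.2.1 * q 1 ≤ h.2.2) : Sees (region gallery) p q := by
  intro z hz
  obtain ⟨t, ht0, ht1, hx, hy⟩ := mem_segment_plane.1 hz
  refine mem_region_gallery.2 (hH _ _ fun h hh => ?_)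
  rw [hx, hy]
  nlinarith [mul_nonneg (sub_nonneg.2 ht1) (sub_nonneg.2 (hp h hh)),
    mul_nonneg ht0 (sub_nonneg.2 (hq h hh))]

lemma guardL_zero : guardL 0 = 37 / 10 - 11 / 5 * √2 := rfl
lemma guardL_one : guardL 1 = 117 / 10 - 11 / 5 * √2 := rfl
lemma guardT_zero : guardT 0 = 37 / 5 - 1 / 2 * √2 := rfl
lemma guardT_one : guardT 1 = 17 / 10 - 1 / 2 * √2 := rfl

lemma sqrt_two_bounds : (1414 / 1000 : ℝ) < √2 ∧ √2 < 1415 / 1000 := by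
  constructor
  · exact Real.lt_sqrt_of_sq_lt (by norm_num)
  · rw [Real.sqrt_lt' (by norm_num)]; norm_num

lemma guardL_sees_square {p : Plane} (h : 0 ≤ p 0 ∧ p 0 ≤ 10 ∧ 0 ≤ p 1 ∧ p 1 ≤ 10) :
    Sees (region gallery) guardL p := by
  obtain ⟨h1, h2, h3, h4⟩ := h
  obtain ⟨hs1, hs2⟩ := sqrt_two_bounds
  apply sees_of_halfplanes [(-1, 0, 0), (1, 0, 10), (0, -1, 0), (0, 1, 10)] <;>
    simp only [List.forall_mem_cons, List.not_mem_nil, false_imp_iff, implies_true, and_true,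
      guardL_zero, guardL_one]
  · rintro x y ⟨k1, k2, k3, k4⟩
    left; refine ⟨?_, ?_, ?_, ?_⟩ <;> linarith
  · refine ⟨?_, ?_, ?_, ?_⟩ <;> linarith
  · refine ⟨?_, ?_, ?_, ?_⟩ <;> linarith

/-- `guardL` lies on y = x + 8, hence in the closed half-planes on both sides of it; this side
serves the left pocket, the other the top-left one. -/
lemma guardL_sees_left {p : Plane} (h1 : p 0 ≤ 0) (h2 : p 0 + 8 ≤ p 1)
    (h3 : p 1 ≤ 8 / 5 * p 0 + 83 / 10) : Sees (region gallery) guardL p := by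
  obtain ⟨hs1, hs2⟩ := sqrt_two_bounds
  apply sees_of_halfplanes [(1, -1, -8), (-8 / 5, 1, 83 / 10), (1, 0, 1)] <;>
    simp only [List.forall_mem_cons, List.not_mem_nil, false_imp_iff, implies_true, and_true,
      guardL_zero, guardL_one]
  · rintro x y ⟨k1, k2, k3⟩
    rcases le_total x 0 with h | h
    · right; left; refine ⟨?_, ?_, ?_⟩ <;> linarith
    · left; refine ⟨?_, ?_, ?_, ?_⟩ <;> linarith
  · refine ⟨?_, ?_, ?_⟩ <;> linarith
  · refine ⟨?_, ?_, ?_⟩ <;> linarith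

lemma guardL_sees_topLeft {p : Plane} (h1 : p 0 ≤ 5 / 2) (h2 : 10 ≤ p 1)
    (h3 : p 1 ≤ p 0 + 8) : Sees (region gallery) guardL p := by
  obtain ⟨hs1, hs2⟩ := sqrt_two_bounds
  apply sees_of_halfplanes [(-1, 1, 8), (-1, 0, 0), (1, 0, 5 / 2), (0, -1, 0)] <;>
    simp only [List.forall_mem_cons, List.not_mem_nil, false_imp_iff, implies_true, and_true,
      guardL_zero, guardL_one]
  · rintro x y ⟨k1, k2, k3, k4⟩
    rcases le_total y 10 with h | h
    · left; refine ⟨?_, ?_, ?_, ?_⟩ <;> linarith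
    · right; right; left; refine ⟨?_, ?_, ?_⟩ <;> linarith
  · refine ⟨?_, ?_, ?_, ?_⟩ <;> linarith
  · refine ⟨?_, ?_, ?_, ?_⟩ <;> linarith

/-- The two cases compare p with the sight lines of `guardL` through (4, 10) and of `guardT` through
(6, 10). The right and bottom pockets are treated alike, with corners (10, 6), (10, 4) and (4, 0),
(6, 0). -/
lemma sees_top {p : Plane} (h1 : 4 ≤ p 0) (h2 : p 0 ≤ 6) (h3 : 10 ≤ p 1)
    (h4 : p 1 ≤ 465522 / 29357 - 76567 / 29357 * (p 0 - 4)) :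
    Sees (region gallery) guardL p ∨ Sees (region gallery) guardT p := by
  obtain ⟨hs1, hs2⟩ := sqrt_two_bounds
  have hs : √2 ^ 2 = 2 := Real.sq_sqrt (by norm_num)
  generalize hsd : √2 = s at *
  rcases le_or_gt ((p 1 - 10) * (11 / 5 * s + 3 / 10)) ((11 / 5 * s - 17 / 10) * (p 0 - 4))
    with hL | hL
  · left
    apply sees_of_halfplanes [(-1, 0, 0), (1, 0, 6), (0, -1, 0),
      (76567 / 29357, 1, 465522 / 29357 + 4 * 76567 / 29357),
      (-(11 / 5 * s - 17 / 10), 11 / 5 * s + 3 / 10,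
        10 * (11 / 5 * s + 3 / 10) - 4 * (11 / 5 * s - 17 / 10))] <;>
      simp only [List.forall_mem_cons, List.not_mem_nil, false_imp_iff, implies_true, and_true,
        guardL_zero, guardL_one, hsd]
    · rintro x y ⟨k1, k2, k3, k4, k5⟩
      rcases le_total y 10 with h | h
      · left; refine ⟨?_, ?_, ?_, ?_⟩ <;> linarith
      · have : 4 ≤ x := by
          by_contra! hx
          nlinarith [mul_pos (sub_pos.2 hx) (by linarith : 0 < 11 / 5 * s - 17 / 10)]
        right; right; right; left; refine ⟨?_, ?_, ?_, ?_⟩ <;> linarith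
    · refine ⟨?_, ?_, ?_, ?_, ?_⟩ <;> linarith
    · refine ⟨?_, ?_, ?_, ?_, ?_⟩ <;> linarith
  rcases le_or_gt ((83 / 10 + 1 / 2 * s) * (p 0 - 6) + (7 / 5 - 1 / 2 * s) * (p 1 - 10)) 0
    with hT | hT
  · right
    apply sees_of_halfplanes [(-1, 0, -4), (1, 0, 10), (0, -1, 0),
      (76567 / 29357, 1, 465522 / 29357 + 4 * 76567 / 29357),
      (83 / 10 + 1 / 2 * s, 7 / 5 - 1 / 2 * s,
        6 * (83 / 10 + 1 / 2 * s) + 10 * (7 / 5 - 1 / 2 * s))] <;>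
      simp only [List.forall_mem_cons, List.not_mem_nil, false_imp_iff, implies_true, and_true,
        guardT_zero, guardT_one, hsd]
    · rintro x y ⟨k1, k2, k3, k4, k5⟩
      rcases le_total y 10 with h | h
      · left; refine ⟨?_, ?_, ?_, ?_⟩ <;> linarith
      · have : x ≤ 6 := by
          by_contra! hx
          nlinarith [mul_pos (sub_pos.2 hx) (by linarith : 0 < 83 / 10 + 1 / 2 * s),
            mul_nonneg (sub_nonneg.2 h) (by linarith : 0 ≤ 7 / 5 - 1 / 2 * s)]
        right; right; right; left; refine ⟨?_, ?_, ?_, ?_⟩ <;> linarith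
    · refine ⟨?_, ?_, ?_, ?_, ?_⟩ <;> linarith
    · refine ⟨?_, ?_, ?_, ?_, ?_⟩ <;> linarith
  · exfalso
    -- The multipliers write the functional of the long edge as a positive combination of the two
    -- sight-line functionals, using s² = 2.
    have a1 := mul_pos (sub_pos.2 hL) (by linarith : 0 < 16490 / 7 + 21340 / 7 * s)
    have a2 := mul_pos hT (by linarith : 0 < 73040 / 7 - 4400 / 7 * s)
    have e : ((p 1 - 10) * (11 / 5 * s + 3 / 10) - (11 / 5 * s - 17 / 10) * (p 0 - 4)) *
          (16490 / 7 + 21340 / 7 * s) +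
        ((83 / 10 + 1 / 2 * s) * (p 0 - 6) + (7 / 5 - 1 / 2 * s) * (p 1 - 10)) *
          (73040 / 7 - 4400 / 7 * s) = 29357 * p 1 - 465522 + 76567 * (p 0 - 4) := by
      linear_combination (21340 / 7 * (11 / 5) * ((p 1 - 10) - (p 0 - 4)) -
        4400 / 7 * (1 / 2) * ((p 0 - 6) - (p 1 - 10))) * hs
    linarith

/-- The pocket is not convex at (117/10, 6). As `guardT` lies on the line y = x - 57/10 through that
vertex, two convex pieces, one of them below this line, suffice. -/
lemma guardT_sees_right {p : Plane} (h1 : 10 ≤ p 0) (h2 : p 0 ≤ 12) (h3 : 4 ≤ p 1)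
    (h4 : 624712 / 107175 + 33669 / 35725 * (p 0 - 12) ≤ p 1)
    (h5 : p 1 ≤ 6 ∨ p 1 ≤ p 0 - 57 / 10)
    (hT : (23 / 10 + 1 / 2 * √2) * (p 0 - 10) - (13 / 5 + 1 / 2 * √2) * (p 1 - 4) ≤ 0) :
    Sees (region gallery) guardT p := by
  obtain ⟨hs1, hs2⟩ := sqrt_two_bounds
  have hs : √2 ^ 2 = 2 := Real.sq_sqrt (by norm_num)
  generalize hsd : √2 = s at *
  by_cases h6 : p 1 ≤ 6 ∧ p 0 ≤ 117 / 10
  · apply sees_of_halfplanes [(-1, 0, -6), (1, 0, 117 / 10), (0, -1, 0), (0, 1, 6),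
      (33669 / 35725, -1, 12 * 33669 / 35725 - 624712 / 107175),
      (23 / 10 + 1 / 2 * s, -(13 / 5 + 1 / 2 * s),
        10 * (23 / 10 + 1 / 2 * s) - 4 * (13 / 5 + 1 / 2 * s))] <;>
      simp only [List.forall_mem_cons, List.not_mem_nil, false_imp_iff, implies_true, and_true,
        guardT_zero, guardT_one, hsd]
    · rintro x y ⟨k1, k2, k3, k4, k5, k6⟩
      rcases le_total x 10 with h | h
      · left; refine ⟨?_, ?_, ?_, ?_⟩ <;> linarith
      · have : 4 ≤ y := by
          by_contra! hy
          nlinarith [mul_pos (sub_pos.2 hy) (by linarith : 0 < 13 / 5 + 1 / 2 * s),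
            mul_nonneg (sub_nonneg.2 h) (by linarith : 0 ≤ 23 / 10 + 1 / 2 * s)]
        right; right; right; right; right
        refine ⟨?_, ?_, ?_, ?_, Or.inl ?_⟩ <;> linarith
    · refine ⟨?_, ?_, ?_, ?_, ?_, ?_⟩ <;> linarith
    · refine ⟨?_, ?_, ?_, ?_, ?_, ?_⟩ <;> linarith
  · have h7 : p 1 ≤ p 0 - 57 / 10 := by
      rcases h5 with h5 | h5
      · by_contra! h7
        exact h6 ⟨h5, by linarith⟩
      · exact h5
    apply sees_of_halfplanes [(-1, 1, -57 / 10), (1, 0, 12), (0, -1, 0),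
      (33669 / 35725, -1, 12 * 33669 / 35725 - 624712 / 107175),
      (23 / 10 + 1 / 2 * s, -(13 / 5 + 1 / 2 * s),
        10 * (23 / 10 + 1 / 2 * s) - 4 * (13 / 5 + 1 / 2 * s))] <;>
      simp only [List.forall_mem_cons, List.not_mem_nil, false_imp_iff, implies_true, and_true,
        guardT_zero, guardT_one, hsd]
    · rintro x y ⟨k1, k2, k3, k4, k5⟩
      rcases le_total x 10 with h | h
      · left; refine ⟨?_, ?_, ?_, ?_⟩ <;> linarith
      · have : 4 ≤ y := by
          by_contra! hy
          nlinarith [mul_pos (sub_pos.2 hy) (by linarith : 0 < 13 / 5 + 1 / 2 * s),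
            mul_nonneg (sub_nonneg.2 h) (by linarith : 0 ≤ 23 / 10 + 1 / 2 * s)]
        right; right; right; right; right
        refine ⟨?_, ?_, ?_, ?_, Or.inr ?_⟩ <;> linarith
    · refine ⟨?_, ?_, ?_, ?_, ?_⟩ <;> linarith
    · refine ⟨?_, ?_, ?_, ?_, ?_⟩ <;> linarith

lemma sees_right {p : Plane} (h1 : 10 ≤ p 0) (h2 : p 0 ≤ 12) (h3 : 4 ≤ p 1)
    (h4 : 624712 / 107175 + 33669 / 35725 * (p 0 - 12) ≤ p 1)
    (h5 : p 1 ≤ 6 ∨ p 1 ≤ p 0 - 57 / 10) :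
    Sees (region gallery) guardL p ∨ Sees (region gallery) guardT p := by
  obtain ⟨hs1, hs2⟩ := sqrt_two_bounds
  have hs : √2 ^ 2 = 2 := Real.sq_sqrt (by norm_num)
  generalize hsd : √2 = s at *
  rcases le_or_gt ((p 1 - 6) * (63 / 10 + 11 / 5 * s) + (57 / 10 - 11 / 5 * s) * (p 0 - 10)) 0
    with hL | hL
  · left
    apply sees_of_halfplanes [(-1, 0, 0), (1, 0, 12), (0, -1, -4), (0, 1, 10),
      (33669 / 35725, -1, 12 * 33669 / 35725 - 624712 / 107175),
      (57 / 10 - 11 / 5 * s, 63 / 10 + 11 / 5 * s,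
        6 * (63 / 10 + 11 / 5 * s) + 10 * (57 / 10 - 11 / 5 * s))] <;>
      simp only [List.forall_mem_cons, List.not_mem_nil, false_imp_iff, implies_true, and_true,
        guardL_zero, guardL_one, hsd]
    · rintro x y ⟨k1, k2, k3, k4, k5, k6⟩
      rcases le_total x 10 with h | h
      · left; refine ⟨?_, ?_, ?_, ?_⟩ <;> linarith
      · have : y ≤ 6 := by
          by_contra! hy
          nlinarith [mul_pos (sub_pos.2 hy) (by linarith : 0 < 63 / 10 + 11 / 5 * s),
            mul_nonneg (sub_nonneg.2 h) (by linarith : 0 ≤ 57 / 10 - 11 / 5 * s)]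
        right; right; right; right; right
        refine ⟨?_, ?_, ?_, ?_, Or.inl ?_⟩ <;> linarith
    · refine ⟨?_, ?_, ?_, ?_, ?_, ?_⟩ <;> linarith
    · have : p 1 ≤ 10 := by rcases h5 with h5 | h5 <;> linarith
      refine ⟨?_, ?_, ?_, ?_, ?_, ?_⟩ <;> linarith
  rcases le_or_gt ((23 / 10 + 1 / 2 * s) * (p 0 - 10) - (13 / 5 + 1 / 2 * s) * (p 1 - 4)) 0
    with hT | hT
  · exact Or.inr (guardT_sees_right h1 h2 h3 h4 h5 (hsd ▸ hT))
  · exfalso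
    have a1 := mul_pos hL (by linarith : 0 < 210 - 220 / 3 * s)
    have a2 := mul_pos hT (by linarith : 0 < 45760 / 3 - 8800 / 3 * s)
    have e : ((p 1 - 6) * (63 / 10 + 11 / 5 * s) + (57 / 10 - 11 / 5 * s) * (p 0 - 10)) *
          (210 - 220 / 3 * s) +
        ((23 / 10 + 1 / 2 * s) * (p 0 - 10) - (13 / 5 + 1 / 2 * s) * (p 1 - 4)) *
          (45760 / 3 - 8800 / 3 * s) = 624712 / 3 + 33669 * (p 0 - 12) - 35725 * p 1 := by
      linear_combination (-220 / 3 * (11 / 5) * ((p 1 - 6) - (p 0 - 10)) -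
        8800 / 3 * (1 / 2) * ((p 0 - 10) - (p 1 - 4))) * hs
    linarith

/-- The reflex vertex (433/100, -137/100) is on y = x - 57/10, as is `guardT`, so each side of this
line is treated with its own convex set. -/
lemma guardT_sees_bottom {p : Plane} (h1 : 4 ≤ p 0) (h2 : p 0 ≤ 6) (h3 : p 1 ≤ 0)
    (h4 : -25442 / 34407 + 9781 / 11469 * (p 0 - 6) ≤ p 1)
    (h5 : p 0 - 57 / 10 ≤ p 1 ∨ -137 / 100 - 2231891 / 584919 * (p 0 - 433 / 100) ≤ p 1)
    (hT : (17 / 10 - 1 / 2 * √2) * (p 0 - 6) - (7 / 5 - 1 / 2 * √2) * p 1 ≤ 0) :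
    Sees (region gallery) guardT p := by
  obtain ⟨hs1, hs2⟩ := sqrt_two_bounds
  have hs : √2 ^ 2 = 2 := Real.sq_sqrt (by norm_num)
  generalize hsd : √2 = s at *
  rcases le_or_gt (p 0 - 57 / 10) (p 1) with h6 | h6
  · apply sees_of_halfplanes [(-1, 0, -4), (1, 0, 10), (0, 1, 10), (1, -1, 57 / 10),
      (9781 / 11469, -1, 6 * 9781 / 11469 + 25442 / 34407),
      (17 / 10 - 1 / 2 * s, -(7 / 5 - 1 / 2 * s), 6 * (17 / 10 - 1 / 2 * s))] <;>
      simp only [List.forall_mem_cons, List.not_mem_nil, false_imp_iff, implies_true, and_true,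
        guardT_zero, guardT_one, hsd]
    · rintro x y ⟨k1, k2, k3, k4, k5, k6⟩
      rcases le_total 0 y with h | h
      · left; refine ⟨?_, ?_, ?_, ?_⟩ <;> linarith
      · have : x ≤ 6 := by linarith
        right; right; right; right; left
        refine ⟨?_, ?_, ?_, ?_, Or.inl ?_⟩ <;> linarith
    · refine ⟨?_, ?_, ?_, ?_, ?_, ?_⟩ <;> linarith
    · refine ⟨?_, ?_, ?_, ?_, ?_, ?_⟩ <;> linarith
  · have h7 : -137 / 100 - 2231891 / 584919 * (p 0 - 433 / 100) ≤ p 1 :=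
      h5.resolve_left (not_le.2 h6)
    apply sees_of_halfplanes [(1, 0, 10), (-1, 1, -57 / 10),
      (-2231891 / 584919, -1, 137 / 100 - 433 / 100 * 2231891 / 584919),
      (9781 / 11469, -1, 6 * 9781 / 11469 + 25442 / 34407),
      (17 / 10 - 1 / 2 * s, -(7 / 5 - 1 / 2 * s), 6 * (17 / 10 - 1 / 2 * s))] <;>
      simp only [List.forall_mem_cons, List.not_mem_nil, false_imp_iff, implies_true, and_true,
        guardT_zero, guardT_one, hsd]
    · rintro x y ⟨k1, k2, k3, k4, k5⟩
      rcases le_total 0 y with h | h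
      · left; refine ⟨?_, ?_, ?_, ?_⟩ <;> linarith
      · have : x ≤ 6 := by
          by_contra! hx
          nlinarith [mul_pos (sub_pos.2 hx) (by linarith : 0 < 17 / 10 - 1 / 2 * s),
            mul_nonneg (sub_nonneg.2 h) (by linarith : 0 ≤ 7 / 5 - 1 / 2 * s)]
        right; right; right; right; left
        refine ⟨?_, ?_, ?_, ?_, Or.inr ?_⟩ <;> linarith
    · refine ⟨?_, ?_, ?_, ?_, ?_⟩ <;> linarith
    · refine ⟨?_, ?_, ?_, ?_, ?_⟩ <;> linarith

lemma sees_bottom {p : Plane} (h1 : 4 ≤ p 0) (h2 : p 0 ≤ 6) (h3 : p 1 ≤ 0)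
    (h4 : -25442 / 34407 + 9781 / 11469 * (p 0 - 6) ≤ p 1)
    (h5 : p 0 - 57 / 10 ≤ p 1 ∨ -137 / 100 - 2231891 / 584919 * (p 0 - 433 / 100) ≤ p 1) :
    Sees (region gallery) guardL p ∨ Sees (region gallery) guardT p := by
  obtain ⟨hs1, hs2⟩ := sqrt_two_bounds
  have hs : √2 ^ 2 = 2 := Real.sq_sqrt (by norm_num)
  generalize hsd : √2 = s at *
  rcases le_or_gt (-(117 / 10 - 11 / 5 * s) * (p 0 - 4) - (3 / 10 + 11 / 5 * s) * p 1) 0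
    with hL | hL
  · left
    apply sees_of_halfplanes [(-1, 0, 0), (1, 0, 6), (0, 1, 10),
      (9781 / 11469, -1, 6 * 9781 / 11469 + 25442 / 34407),
      (-(117 / 10 - 11 / 5 * s), -(3 / 10 + 11 / 5 * s), -4 * (117 / 10 - 11 / 5 * s))] <;>
      simp only [List.forall_mem_cons, List.not_mem_nil, false_imp_iff, implies_true, and_true,
        guardL_zero, guardL_one, hsd]
    · rintro x y ⟨k1, k2, k3, k4, k5⟩
      rcases le_total 0 y with h | h
      · left; refine ⟨?_, ?_, ?_, ?_⟩ <;> linarith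
      · have : 4 ≤ x := by
          by_contra! hx
          nlinarith [mul_pos (sub_pos.2 hx) (by linarith : 0 < 117 / 10 - 11 / 5 * s),
            mul_nonneg (sub_nonneg.2 h) (by linarith : 0 ≤ 3 / 10 + 11 / 5 * s)]
        -- The sight line through (4, 0) has slope about -2.52; the steeper rational slope -2.6
        -- still passes above the reflex vertex.
        have hy : -(26 / 10) * (x - 4) ≤ y := by
          by_contra! hy
          nlinarith [mul_pos (sub_pos.2 hy) (by linarith : 0 < 3 / 10 + 11 / 5 * s),
            mul_nonneg (sub_nonneg.2 this)
              (by linarith : 0 ≤ (26 / 10) * (3 / 10 + 11 / 5 * s) - (117 / 10 - 11 / 5 * s))]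
        right; right; right; right; left
        refine ⟨?_, ?_, ?_, ?_, ?_⟩ <;> try linarith
        rcases le_total x (44 / 10) with h' | h'
        · left; linarith
        · right; linarith
    · refine ⟨?_, ?_, ?_, ?_, ?_⟩ <;> linarith
    · refine ⟨?_, ?_, ?_, ?_, ?_⟩ <;> linarith
  rcases le_or_gt ((17 / 10 - 1 / 2 * s) * (p 0 - 6) - (7 / 5 - 1 / 2 * s) * p 1) 0
    with hT | hT
  · exact Or.inr (guardT_sees_bottom h1 h2 h3 h4 h5 (hsd ▸ hT))
  · exfalso
    have a1 := mul_pos hL (by linarith : 0 < 390 + 220 / 3 * s)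
    have a2 := mul_pos hT (by linarith : 0 < 29920 / 3 + 8800 / 3 * s)
    have e : (-(117 / 10 - 11 / 5 * s) * (p 0 - 4) - (3 / 10 + 11 / 5 * s) * p 1) *
          (390 + 220 / 3 * s) +
        ((17 / 10 - 1 / 2 * s) * (p 0 - 6) - (7 / 5 - 1 / 2 * s) * p 1) *
          (29920 / 3 + 8800 / 3 * s) = -25442 / 3 + 9781 * (p 0 - 6) - 11469 * p 1 := by
      linear_combination (220 / 3 * (11 / 5) * ((p 0 - 4) - p 1) -
        8800 / 3 * (1 / 2) * ((p 0 - 6) - p 1)) * hs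
    linarith

theorem isGuardSet_guardL_guardT : IsGuardSet (region gallery) {guardL, guardT} := by
  constructor
  · obtain ⟨hs1, hs2⟩ := sqrt_two_bounds
    rintro p (rfl | rfl) <;> rw [mem_region_gallery]
    · rw [guardL_zero, guardL_one]
      left; refine ⟨?_, ?_, ?_, ?_⟩ <;> linarith
    · rw [guardT_zero, guardT_one]
      left; refine ⟨?_, ?_, ?_, ?_⟩ <;> linarith
  · intro p hp
    have key : Sees (region gallery) guardL p ∨ Sees (region gallery) guardT p := by
      rcases mem_region_gallery.1 hp with h | ⟨h1, h2, h3⟩ | ⟨h1, h2, h3⟩ | ⟨h1, h2, h3, h4⟩ |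
        ⟨h1, h2, h3, h4, h5⟩ | ⟨h1, h2, h3, h4, h5⟩
      · exact Or.inl (guardL_sees_square h)
      · exact Or.inl (guardL_sees_left h1 h2 h3)
      · exact Or.inl (guardL_sees_topLeft h1 h2 h3)
      · exact sees_top h1 h2 h3 h4
      · exact sees_bottom h1 h2 h3 h4 h5
      · exact sees_right h1 h2 h3 h4 h5
    rcases key with h | h
    · exact ⟨guardL, by simp, h⟩
    · exact ⟨guardT, by simp, h⟩

/-! ### Segments passing the openings of the pockets -/

/-- Let x tend to c. The limit is needed because at the abscissa of a corner the gallery also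
contains a pocket wall, so the bound holds only on one side. -/
lemma nonpos_of_forall_right {α β c d : ℝ} (hcd : c < d)
    (h : ∀ x, c < x → x ≤ d → α + β * (x - c) ≤ 0) : α ≤ 0 := by
  by_contra! hα
  have hβ : 0 < 2 * (|β| + 1) := by positivity
  have hx : 0 < min (d - c) (α / (2 * (|β| + 1))) := lt_min (by linarith) (by positivity)
  have h1 := h (c + min (d - c) (α / (2 * (|β| + 1)))) (by linarith)
    (by linarith [min_le_left (d - c) (α / (2 * (|β| + 1)))])
  have h2 := min_le_right (d - c) (α / (2 * (|β| + 1)))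
  rw [le_div_iff₀ hβ] at h2
  generalize min (d - c) (α / (2 * (|β| + 1))) = e at *
  nlinarith [neg_abs_le β]

lemma nonpos_of_forall_left {α β c d : ℝ} (hcd : d < c)
    (h : ∀ x, d ≤ x → x < c → α + β * (x - c) ≤ 0) : α ≤ 0 :=
  nonpos_of_forall_right (β := -β) (neg_lt_neg hcd) fun x h1 h2 => by
    linarith [h (-x) (by linarith) (by linarith)]

lemma Sees.symm {R : Set Plane} {p q : Plane} (h : Sees R p q) : Sees R q p := by
  rwa [Sees, segment_symm]

/-- A segment in the gallery, parametrized by the abscissa. -/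
lemma Sees.exists_slope {p q : Plane} (h : Sees (region gallery) p q) (hpq : p 0 < q 0) :
    ∃ m : ℝ, q 1 = p 1 + m * (q 0 - p 0) ∧
      ∀ x, p 0 ≤ x → x ≤ q 0 → InGallery x (p 1 + m * (x - p 0)) := by
  have h0 : q 0 - p 0 ≠ 0 := by linarith
  refine ⟨(q 1 - p 1) / (q 0 - p 0), by field_simp; ring, fun x h1 h2 => ?_⟩
  have := @h !₂[x, p 1 + (q 1 - p 1) / (q 0 - p 0) * (x - p 0)] (mem_segment_plane.2
    ⟨(x - p 0) / (q 0 - p 0), div_nonneg (by linarith) (by linarith),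
      (div_le_one (by linarith)).2 (by linarith), ?_, ?_⟩)
  · exact mem_region_gallery.1 this
  · change x = _
    field_simp; ring
  · change p 1 + (q 1 - p 1) / (q 0 - p 0) * (x - p 0) = _
    ring

lemma InGallery.nonneg_of_lt_four {x y : ℝ} (h : InGallery x y) (hx : x < 4) : 0 ≤ y := by
  rcases h with ⟨h1, h2, h3, h4⟩ | ⟨h1, h2, h3⟩ | ⟨h1, h2, h3⟩ | ⟨h1, h2, h3, h4⟩ |
    ⟨h1, h2, h3, h4, h5⟩ | ⟨h1, h2, h3, h4, h5⟩ <;> linarith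

lemma InGallery.le_ten {x y : ℝ} (h : InGallery x y) (hx : 5 / 2 < x) (hx' : x < 4 ∨ 6 < x) :
    y ≤ 10 := by
  rcases h with ⟨h1, h2, h3, h4⟩ | ⟨h1, h2, h3⟩ | ⟨h1, h2, h3⟩ | ⟨h1, h2, h3, h4⟩ |
    ⟨h1, h2, h3, h4, h5⟩ | ⟨h1, h2, h3, h4, h5 | h5⟩ <;>
  rcases hx' with hx' | hx' <;> linarith

lemma InGallery.nonneg_of_six_lt {x y : ℝ} (h : InGallery x y) (hx : 6 < x) : 0 ≤ y := by
  rcases h with ⟨h1, h2, h3, h4⟩ | ⟨h1, h2, h3⟩ | ⟨h1, h2, h3⟩ | ⟨h1, h2, h3, h4⟩ |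
    ⟨h1, h2, h3, h4, h5⟩ | ⟨h1, h2, h3, h4, h5⟩ <;> linarith

lemma InGallery.bounds_of_ten_lt {x y : ℝ} (h : InGallery x y) (hx : 10 < x) :
    4 ≤ y ∧ (y ≤ 6 ∨ y ≤ x - 57 / 10) := by
  rcases h with ⟨h1, h2, h3, h4⟩ | ⟨h1, h2, h3⟩ | ⟨h1, h2, h3⟩ | ⟨h1, h2, h3, h4⟩ |
    ⟨h1, h2, h3, h4, h5⟩ | ⟨h1, h2, h3, h4, h5⟩
  on_goal 6 => exact ⟨h3, h5⟩
  all_goals linarith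

/-- A segment crossing the abscissa 4 from the left does so between the two corners there. -/
lemma Sees.crossing_four {p q : Plane} (h : Sees (region gallery) p q) (hp : p 0 < 4)
    (hq : 4 ≤ q 0) : 0 ≤ p 1 * (q 0 - 4) + q 1 * (4 - p 0) ∧
      p 1 * (q 0 - 4) + q 1 * (4 - p 0) ≤ 10 * (q 0 - p 0) := by
  obtain ⟨m, hm, hin⟩ := h.exists_slope (hp.trans_le hq)
  have e : p 1 * (q 0 - 4) + q 1 * (4 - p 0) = (p 1 + m * (4 - p 0)) * (q 0 - p 0) := by
    rw [hm]; ring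
  have h1 : -(p 1 + m * (4 - p 0)) ≤ 0 := by
    refine nonpos_of_forall_left (β := -m) (d := max (p 0) 3) (max_lt hp (by norm_num))
      fun x hx hx' => ?_
    have hx := max_le_iff.1 hx
    linarith [(hin x hx.1 (by linarith)).nonneg_of_lt_four hx']
  have h2 : (p 1 + m * (4 - p 0)) - 10 ≤ 0 := by
    -- Starting at 3 or later keeps x to the right of the top-left pocket, which ends at 5/2.
    refine nonpos_of_forall_left (β := m) (d := max (p 0) 3) (max_lt hp (by norm_num))
      fun x hx hx' => ?_
    have hx := max_le_iff.1 hx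
    linarith [(hin x hx.1 (by linarith)).le_ten (by linarith) (Or.inl hx')]
  rw [e]
  constructor
  · exact mul_nonneg (by linarith) (by linarith)
  · exact mul_le_mul_of_nonneg_right (by linarith) (by linarith)

/-- A segment crossing the abscissa 6 from the right does so between the two corners there. -/
lemma Sees.crossing_six {p q : Plane} (h : Sees (region gallery) p q) (hp : p 0 ≤ 6)
    (hq : 6 < q 0) : 0 ≤ p 1 * (q 0 - 6) + q 1 * (6 - p 0) ∧
      p 1 * (q 0 - 6) + q 1 * (6 - p 0) ≤ 10 * (q 0 - p 0) := by
  obtain ⟨m, hm, hin⟩ := h.exists_slope (hp.trans_lt hq)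
  have e : p 1 * (q 0 - 6) + q 1 * (6 - p 0) = (p 1 + m * (6 - p 0)) * (q 0 - p 0) := by
    rw [hm]; ring
  have h1 : -(p 1 + m * (6 - p 0)) ≤ 0 := by
    refine nonpos_of_forall_right (β := -m) hq fun x hx hx' => ?_
    linarith [(hin x (by linarith) hx').nonneg_of_six_lt hx]
  have h2 : (p 1 + m * (6 - p 0)) - 10 ≤ 0 := by
    refine nonpos_of_forall_right (β := m) hq fun x hx hx' => ?_
    linarith [(hin x (by linarith) hx').le_ten (by linarith) (Or.inr hx)]
  rw [e]
  constructor
  · exact mul_nonneg (by linarith) (by linarith)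
  · exact mul_le_mul_of_nonneg_right (by linarith) (by linarith)

/-- A segment crossing the abscissa 10 does so between the two corners there. -/
lemma Sees.crossing_ten {p q : Plane} (h : Sees (region gallery) p q) (hp : p 0 < 10)
    (hq : 10 < q 0) : 4 * (q 0 - p 0) ≤ p 1 * (q 0 - 10) + q 1 * (10 - p 0) ∧
      p 1 * (q 0 - 10) + q 1 * (10 - p 0) ≤ 6 * (q 0 - p 0) := by
  obtain ⟨m, hm, hin⟩ := h.exists_slope (hp.trans hq)
  have e : p 1 * (q 0 - 10) + q 1 * (10 - p 0) = (p 1 + m * (10 - p 0)) * (q 0 - p 0) := by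
    rw [hm]; ring
  have h1 : 4 - (p 1 + m * (10 - p 0)) ≤ 0 := by
    refine nonpos_of_forall_right (β := -m) hq fun x hx hx' => ?_
    linarith [((hin x (by linarith) hx').bounds_of_ten_lt hx).1]
  have h2 : (p 1 + m * (10 - p 0)) - 6 ≤ 0 := by
    -- Up to abscissa 11 < 117/10 the ceiling of the right pocket is at height 6.
    refine nonpos_of_forall_right (β := m) (d := min (q 0) 11) (lt_min hq (by norm_num))
      fun x hx hx' => ?_
    have hx' := le_min_iff.1 hx'
    rcases ((hin x (by linarith) hx'.1).bounds_of_ten_lt hx).2 with h | h <;> linarith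
  rw [e]
  constructor
  · exact mul_le_mul_of_nonneg_right (by linarith) (by linarith)
  · exact mul_le_mul_of_nonneg_right (by linarith) (by linarith)

/-! ### The four spikes -/

/-- Near the tip the pocket lies above y = x + 8, which passes through the tip, so a segment leaving
the tip has slope at least 1. Beyond abscissa 5/2 it would then be above height 10. -/
lemma Sees.left_spike {g : Plane} (h : Sees (region gallery) g !₂[-1 / 2, 15 / 2]) :
    -1 / 2 ≤ g 0 ∧ g 0 ≤ 5 / 2 ∧ g 0 + 8 ≤ g 1 := by
  have hg := mem_region_gallery.1 (h (left_mem_segment ℝ _ _))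
  have h0 := hg.bounds.1
  rcases h0.eq_or_lt with h1 | h1
  · refine ⟨h0, by linarith, ?_⟩
    rcases hg with hg | hg | hg | hg | hg | hg <;> linarith
  obtain ⟨m, hm, hin⟩ := h.symm.exists_slope h1
  change g 1 = 15 / 2 + m * (g 0 - -1 / 2) at hm
  change ∀ x, -1 / 2 ≤ x → x ≤ g 0 → InGallery x (15 / 2 + m * (x - -1 / 2)) at hin
  have hm1 : 1 ≤ m := by
    have hx : -1 / 2 < min (g 0) (-1 / 4) := lt_min h1 (by norm_num)
    have k := hin _ hx.le (min_le_left _ _)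
    have k' := min_le_right (g 0) (-1 / 4)
    generalize min (g 0) (-1 / 4) = x at *
    have : x + 8 ≤ 15 / 2 + m * (x - -1 / 2) := by
      rcases k with k | k | k | k | k | k <;> linarith
    by_contra! hlt
    nlinarith
  refine ⟨h0, ?_, by nlinarith⟩
  by_contra! h2
  have hx : 5 / 2 < min (g 0) 3 := lt_min h2 (by norm_num)
  have k := hin (min (g 0) 3) (by linarith) (min_le_left _ _)
  have k' := min_le_right (g 0) 3
  generalize min (g 0) 3 = x at *
  nlinarith [k.le_ten hx (Or.inl (by linarith))]

/-- The tip is on the vertical wall x = 5/2, right of which the gallery stops at height 10; the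
segment therefore arrives from the left, below y = x + 8. -/
lemma Sees.topLeft_spike {g : Plane} (h : Sees (region gallery) g !₂[5 / 2, 21 / 2]) :
    g 0 ≤ 5 / 2 ∧ g 1 ≤ g 0 + 8 := by
  have hg := mem_region_gallery.1 (h (left_mem_segment ℝ _ _))
  have h0 : g 0 ≤ 5 / 2 := by
    by_contra! h1
    obtain ⟨m, hm, hin⟩ := h.symm.exists_slope h1
    change ∀ x, 5 / 2 ≤ x → x ≤ g 0 → InGallery x (21 / 2 + m * (x - 5 / 2)) at hin
    have : (1 / 2 : ℝ) ≤ 0 := by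
      refine nonpos_of_forall_right (β := m) (d := min (g 0) 3) (lt_min h1 (by norm_num))
        fun x hx hx' => ?_
      have hx' := le_min_iff.1 hx'
      linarith [(hin x hx.le hx'.1).le_ten hx (Or.inl (by linarith))]
    norm_num at this
  refine ⟨h0, ?_⟩
  rcases h0.eq_or_lt with h1 | h1
  · rcases hg with hg | hg | hg | hg | hg | hg <;> linarith
  obtain ⟨m, hm, hin⟩ := h.exists_slope h1
  change 21 / 2 = g 1 + m * (5 / 2 - g 0) at hm
  change ∀ x, g 0 ≤ x → x ≤ 5 / 2 → InGallery x (g 1 + m * (x - g 0)) at hin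
  have hx : max (g 0) (9 / 4) < 5 / 2 := max_lt h1 (by norm_num)
  have k := hin _ (le_max_left _ _) hx.le
  have k' := le_max_right (g 0) (9 / 4)
  generalize max (g 0) (9 / 4) = x at *
  have : g 1 + m * (x - g 0) ≤ x + 8 := by
    rcases k with k | k | k | k | k | k <;> linarith
  have : 1 ≤ m := by
    by_contra! hlt
    nlinarith
  nlinarith

lemma Sees.right_spike {g : Plane} (h : Sees (region gallery) g !₂[12, 63 / 10]) :
    4 ≤ g 0 ∧ g 1 ≤ g 0 - 57 / 10 := by
  have hg := mem_region_gallery.1 (h (left_mem_segment ℝ _ _))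
  have key : g 1 ≤ g 0 - 57 / 10 := by
    rcases hg.bounds.2.1.eq_or_lt with h1 | h1
    · rcases (hg.bounds_of_ten_lt (by linarith)).2 with h | h <;> linarith
    obtain ⟨m, hm, hin⟩ := h.exists_slope h1
    change 63 / 10 = g 1 + m * (12 - g 0) at hm
    change ∀ x, g 0 ≤ x → x ≤ 12 → InGallery x (g 1 + m * (x - g 0)) at hin
    have hx : max (g 0) (119 / 10) < 12 := max_lt h1 (by norm_num)
    have k := hin _ (le_max_left _ _) hx.le
    have k' := le_max_right (g 0) (119 / 10)
    generalize max (g 0) (119 / 10) = x at *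
    have : g 1 + m * (x - g 0) ≤ x - 57 / 10 := by
      rcases (k.bounds_of_ten_lt (by linarith)).2 with h | h <;> linarith
    have : 1 ≤ m := by
      by_contra! hlt
      nlinarith
    nlinarith
  refine ⟨?_, key⟩
  by_contra! h1
  linarith [hg.nonneg_of_lt_four h1]

/-- The wall x = 4 blocks every view from the left, and the spike lies above y = x - 57/10 near its
tip. -/
lemma Sees.bottom_spike {g : Plane} (h : Sees (region gallery) g !₂[4, -17 / 10]) :
    4 ≤ g 0 ∧ g 0 - 57 / 10 ≤ g 1 := by
  have hg := mem_region_gallery.1 (h (left_mem_segment ℝ _ _))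
  have h0 : 4 ≤ g 0 := by
    by_contra! h1
    have := (h.crossing_four h1 le_rfl).1
    change 0 ≤ g 1 * (4 - 4) + -17 / 10 * (4 - g 0) at this
    linarith
  refine ⟨h0, ?_⟩
  rcases h0.eq_or_lt with h1 | h1
  · rcases hg with hg | hg | hg | hg | ⟨-, -, -, -, hg | hg⟩ | hg <;> linarith
  obtain ⟨m, hm, hin⟩ := h.symm.exists_slope h1
  change g 1 = -17 / 10 + m * (g 0 - 4) at hm
  change ∀ x, 4 ≤ x → x ≤ g 0 → InGallery x (-17 / 10 + m * (x - 4)) at hin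
  have hx : 4 < min (g 0) (42 / 10) := lt_min h1 (by norm_num)
  have k := hin _ hx.le (min_le_left _ _)
  have k' := min_le_right (g 0) (42 / 10)
  generalize min (g 0) (42 / 10) = x at *
  have : x - 57 / 10 ≤ -17 / 10 + m * (x - 4) := by
    rcases k with k | k | k | k | ⟨-, -, -, -, k | k⟩ | k <;> linarith
  have : 1 ≤ m := by
    by_contra! hlt
    nlinarith
  nlinarith

/-! ### Covering the three long edges -/

/-- Two affine functions, at least one of which is nonnegative at each point of the unit interval,
the first one being negative at the left end and nonnegative at the right end. -/
lemma det_nonneg_of_forall_or {f₀ f₁ g₀ g₁ : ℝ} (hf₀ : f₀ < 0) (hf₁ : 0 ≤ f₁)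
    (h : ∀ t : ℝ, 0 ≤ t → t ≤ 1 → 0 ≤ f₀ + t * (f₁ - f₀) ∨ 0 ≤ g₀ + t * (g₁ - g₀)) :
    0 ≤ f₁ * g₀ - f₀ * g₁ := by
  have hd : 0 < f₁ - f₀ := by linarith
  -- c is the zero of the first function. Just left of it the second must be nonnegative, hence also
  -- at c, where its value is the determinant divided by f₁ - f₀.
  obtain ⟨c, hc⟩ : ∃ c, c = -f₀ / (f₁ - f₀) := ⟨_, rfl⟩
  have hc' : c * (f₁ - f₀) = -f₀ := by rw [hc]; field_simp
  have hc0 : 0 < c := by rw [hc]; exact div_pos (by linarith) hd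
  have hc1 : c ≤ 1 := by rw [hc]; exact (div_le_one hd).2 (by linarith)
  have key : -(g₀ + c * (g₁ - g₀)) ≤ 0 := by
    refine nonpos_of_forall_left (β := -(g₁ - g₀)) hc0 fun t ht ht' => ?_
    rcases h t ht (by linarith) with h | h
    · nlinarith [mul_pos (sub_pos.2 ht') hd]
    · linarith
  have e : f₁ * g₀ - f₀ * g₁ = (g₀ + c * (g₁ - g₀)) * (f₁ - f₀) := by
    linear_combination (g₀ - g₁) * hc'
  rw [e]
  exact mul_nonneg (by linarith) hd.le

/-- The three bilinear inequalities expressing that the three long pocket edges are covered have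
exactly one solution in the relevant range. -/
lemma eq_of_bilinear_inequalities {a b : ℝ} (ha : a ≤ 5 / 2)
    (h1 : -70239 + 9950 * b + 42734 * a - 5460 * (a * b) ≤ 0)
    (h2 : 269330 - 40705 * b - 11928 * a + 2570 * (a * b) ≤ 0)
    (h3 : -616793 + 93450 * b + 13538 * a - 4220 * (a * b) ≤ 0) :
    a = 37 / 10 - 11 / 5 * √2 ∧ b = 37 / 5 - 1 / 2 * √2 := by
  obtain ⟨hs1, hs2⟩ := sqrt_two_bounds
  have hs : √2 ^ 2 = 2 := Real.sq_sqrt (by norm_num)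
  generalize √2 = s at *
  -- Multiplying `h2` and `h3` by the opposite coefficients of b eliminates b. The smaller root is
  -- the lower bound for a.
  have hq : a ^ 2 - 37 / 5 * a + 401 / 100 ≤ 0 := by
    nlinarith [mul_nonneg (sub_nonneg.2 h2) (by linarith : 0 ≤ 93450 - 4220 * a),
      mul_nonneg (sub_nonneg.2 h3) (by linarith : 0 ≤ 40705 - 2570 * a)]
  have hb : b ≤ 15 / 2 := by
    by_contra! hb
    nlinarith [mul_pos (sub_pos.2 hb) (by linarith : 0 < 93450 - 4220 * a)]
  have ha1 : 0 ≤ a - (37 / 10 - 11 / 5 * s) := by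
    by_contra! h
    nlinarith [mul_pos (sub_pos.2 h) (by linarith : 0 < 37 / 10 + 11 / 5 * s - a)]
  have hb1 : 0 ≤ b - (37 / 5 - 1 / 2 * s) := by
    have e : 269330 - 40705 * b - 11928 * a + 2570 * (a * b) =
        (7090 - 1285 * s) * (a - (37 / 10 - 11 / 5 * s)) -
        (40705 - 2570 * a) * (b - (37 / 5 - 1 / 2 * s)) := by
      linear_combination (2570 * (11 / 10)) * hs
    by_contra! h
    nlinarith [mul_nonneg (by linarith : 0 ≤ 7090 - 1285 * s) ha1,
      mul_pos (by linarith : 0 < 40705 - 2570 * a) (neg_pos.2 h)]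
  -- Expanded at the solution, `h1` bounds above by 0 a combination, with positive coefficients, of
  -- two nonnegative differences.
  have e : -70239 + 9950 * b + 42734 * a - 5460 * (a * b) =
      (42734 - 5460 * b) * (a - (37 / 10 - 11 / 5 * s)) +
      (9950 - 5460 * (37 / 10 - 11 / 5 * s)) * (b - (37 / 5 - 1 / 2 * s)) := by
    linear_combination (-5460 * (11 / 10)) * hs
  have p1 : 0 < 42734 - 5460 * b := by linarith
  have p2 : 0 < 9950 - 5460 * (37 / 10 - 11 / 5 * s) := by linarith
  have k1 := mul_nonneg p1.le ha1
  have k2 := mul_nonneg p2.le hb1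
  constructor
  · have : (42734 - 5460 * b) * (a - (37 / 10 - 11 / 5 * s)) = 0 := by linarith
    linarith [(mul_eq_zero.1 this).resolve_left p1.ne']
  · have : (9950 - 5460 * (37 / 10 - 11 / 5 * s)) * (b - (37 / 5 - 1 / 2 * s)) = 0 := by
      linarith
    linarith [(mul_eq_zero.1 this).resolve_left p2.ne']

/-- Necessary conditions on the guards `(a, a + 8)` and `(b, b - 57 / 10)`. -/
lemma eq_of_isGuardSet_on_lines {l t : Plane} (hg : IsGuardSet (region gallery) {l, t})
    (ha : -1 / 2 ≤ l 0) (ha' : l 0 ≤ 5 / 2) (hl : l 1 = l 0 + 8) (hb : 4 ≤ t 0)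
    (ht : t 1 = t 0 - 57 / 10) : l = guardL ∧ t = guardT := by
  have hsee : ∀ x y : ℝ, InGallery x y →
      Sees (region gallery) l !₂[x, y] ∨ Sees (region gallery) t !₂[x, y] := by
    intro x y h
    obtain ⟨g, hg, hs⟩ := hg.2 !₂[x, y] (mem_region_gallery.2 h)
    rcases hg with rfl | rfl
    · exact Or.inl hs
    · exact Or.inr hs
  have c4 : ∀ x y : ℝ, Sees (region gallery) l !₂[x, y] → 4 ≤ x →
      0 ≤ (l 0 + 8) * (x - 4) + y * (4 - l 0) ∧
      (l 0 + 8) * (x - 4) + y * (4 - l 0) ≤ 10 * (x - l 0) := by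
    intro x y h hx
    rw [← hl]
    exact h.crossing_four (by linarith) hx
  have c10 : ∀ x y : ℝ, Sees (region gallery) l !₂[x, y] → 10 < x →
      (l 0 + 8) * (x - 10) + y * (10 - l 0) ≤ 6 * (x - l 0) := by
    intro x y h hx
    rw [← hl]
    exact (h.crossing_ten (by linarith) hx).2
  have d6 : ∀ x y : ℝ, Sees (region gallery) t !₂[x, y] → x ≤ 6 → 6 < t 0 →
      0 ≤ y * (t 0 - 6) + (t 0 - 57 / 10) * (6 - x) ∧
      y * (t 0 - 6) + (t 0 - 57 / 10) * (6 - x) ≤ 10 * (t 0 - x) := by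
    intro x y h hx h6
    rw [← ht]
    exact h.symm.crossing_six hx h6
  have d10 : ∀ x y : ℝ, Sees (region gallery) t !₂[x, y] → 10 < x → t 0 < 10 →
      4 * (x - t 0) ≤ (t 0 - 57 / 10) * (x - 10) + y * (10 - t 0) := by
    intro x y h hx h10
    rw [← ht]
    exact (h.crossing_ten h10 hx).1
  clear hg
  obtain ⟨a, hadef⟩ : ∃ a, a = l 0 := ⟨_, rfl⟩
  obtain ⟨b, hbdef⟩ : ∃ b, b = t 0 := ⟨_, rfl⟩
  rw [← hadef] at ha ha' c4 c10
  rw [← hbdef] at hb d6 d10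
  -- The lower end of the right wall is hidden from l. That t must see it gives b > 6, as needed for
  -- crossing the abscissa 6.
  have hb1 : 649 / 100 ≤ b := by
    rcases lt_or_ge b 10 with h10 | h10
    · rcases hsee 12 (624712 / 107175) (by
        right; right; right; right; right
        refine ⟨?_, ?_, ?_, ?_, Or.inl ?_⟩ <;> norm_num) with h | h
      · linarith [c10 _ _ h (by norm_num)]
      · linarith [d10 _ _ h (by norm_num) h10]
    · linarith
  -- The top of the wall x = 4 is hidden from l by the corner (4, 10).
  have hb2 : b ≤ 848 / 100 := by
    rcases hsee 4 (465522 / 29357) (by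
      right; right; right; left
      refine ⟨?_, ?_, ?_, ?_⟩ <;> norm_num) with h | h
    · linarith [(c4 _ _ h le_rfl).2]
    · linarith [(d6 _ _ h (by norm_num) (by linarith)).2]
  have h1 : -70239 + 9950 * b + 42734 * a - 5460 * (a * b) ≤ 0 := by
    -- f and g are the slacks in the crossing conditions for l and t at the two ends of the edge;
    -- each is affine along the edge.
    have := det_nonneg_of_forall_or (f₀ := -687808 / 29357 + 171952 / 29357 * a)
      (f₁ := 42156 / 29357 - 39896 / 29357 * a)
      (g₀ := 9767609 / 146785 - 230666 / 29357 * b)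
      (g₁ := 112908 / 29357 - 18818 / 29357 * b) (by linarith) ?_ ?_
    · linarith
    · rcases hsee 6 (312388 / 29357) (by
        right; right; right; left
        refine ⟨?_, ?_, ?_, ?_⟩ <;> norm_num) with h | h
      · linarith [(c4 _ _ h (by norm_num)).2]
      · linarith [(d6 _ _ h le_rfl (by linarith)).2]
    · intro u hu0 hu1
      rcases hsee (4 + u * 2) (465522 / 29357 - 76567 / 29357 * (u * 2)) (by
        right; right; right; left
        refine ⟨?_, ?_, ?_, ?_⟩ <;> linarith) with h | h
      · left; linarith [(c4 _ _ h (by linarith)).2]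
      · right; linarith [(d6 _ _ h (by linarith) (by linarith)).2]
  have h2 : 269330 - 40705 * b - 11928 * a + 2570 * (a * b) ≤ 0 := by
    have := det_nonneg_of_forall_or (f₀ := -(49064 / 21435 + 232688 / 107175 * a))
      (f₁ := 2008136 / 101007 - 208016 / 101007 * a)
      (g₀ := -4763 / 4287 + 18338 / 107175 * b)
      (g₁ := -291097 / 505035 + 6002 / 101007 * b) (by linarith) (by linarith) ?_
    · linarith
    · intro u hu0 hu1
      rcases hsee (12 + u * (1016072 / 101007 - 12))
        (624712 / 107175 + u * (4 - 624712 / 107175)) (by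
        right; right; right; right; right
        refine ⟨?_, ?_, ?_, ?_, Or.inl ?_⟩ <;> linarith) with h | h
      · left; linarith [c10 _ _ h (by linarith)]
      · right; linarith [d10 _ _ h (by linarith) (by linarith)]
  have h3 : -616793 + 93450 * b + 13538 * a - 4220 * (a * b) ≤ 0 := by
    -- l misses the left end of the long bottom edge: otherwise a would be so large that `h1` fails
    -- for b in the range just found.
    have hf : -140198 / 34407 + 86660 / 34407 * a < 0 := by
      by_contra! hf
      nlinarith [mul_nonneg (by linarith : 0 ≤ a - 16 / 10) (sub_nonneg.2 hb2)]
    have := det_nonneg_of_forall_or (f₀ := -140198 / 34407 + 86660 / 34407 * a)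
      (f₁ := 448744 / 34407 + 94256 / 34407 * a)
      (g₀ := 817061 / 229380 - 17846 / 34407 * b)
      (g₁ := 50884 / 11469 - 25442 / 34407 * b) hf (by linarith) ?_
    · linarith
    · intro u hu0 hu1
      rcases hsee (9 / 2 + u * (3 / 2))
        (-138913 / 68814 + u * (-25442 / 34407 - -138913 / 68814)) (by
        right; right; right; right; left
        refine ⟨?_, ?_, ?_, ?_, Or.inr ?_⟩ <;> linarith) with h | h
      · left; linarith [(c4 _ _ h (by linarith)).1]
      · right; linarith [(d6 _ _ h (by linarith) (by linarith)).1]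
  obtain ⟨e1, e2⟩ := eq_of_bilinear_inequalities ha' h1 h2 h3
  constructor
  · refine plane_ext (hadef.symm.trans e1) ?_
    rw [hl, ← hadef, e1, guardL_one]; ring
  · refine plane_ext (hbdef.symm.trans e2) ?_
    rw [ht, ← hbdef, e2, guardT_one]; ring

theorem pair_eq_of_isGuardSet {g h : Plane} (hgh : IsGuardSet (region gallery) {g, h}) :
    ({g, h} : Set Plane) = {guardL, guardT} := by
  have hsee : ∀ x y : ℝ, InGallery x y →
      Sees (region gallery) g !₂[x, y] ∨ Sees (region gallery) h !₂[x, y] := by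
    intro x y hxy
    obtain ⟨k, hk, hs⟩ := hgh.2 !₂[x, y] (mem_region_gallery.2 hxy)
    rcases hk with rfl | rfl
    · exact Or.inl hs
    · exact Or.inr hs
  have hA := hsee (-1 / 2) (15 / 2) (by
    right; left; norm_num)
  have hB := hsee (5 / 2) (21 / 2) (by
    right; right; left; norm_num)
  have hC := hsee 12 (63 / 10) (by
    right; right; right; right; right
    refine ⟨?_, ?_, ?_, ?_, Or.inr ?_⟩ <;> norm_num)
  have hD := hsee 4 (-17 / 10) (by
    right; right; right; right; left
    refine ⟨?_, ?_, ?_, ?_, Or.inl ?_⟩ <;> norm_num)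
  -- The left tips need abscissa at most 5/2 and the other two at least 4, so whichever guard sees
  -- the left tip also sees the top-left one, and the other guard sees the remaining two.
  rcases hA with hA | hA
  · have a := hA.left_spike
    have c := (hC.resolve_left fun k => by linarith [k.right_spike.1]).right_spike
    have d := (hD.resolve_left fun k => by linarith [k.bottom_spike.1]).bottom_spike
    have b := (hB.resolve_right fun k => by linarith [k.topLeft_spike.1]).topLeft_spike
    obtain ⟨rfl, rfl⟩ := eq_of_isGuardSet_on_lines hgh a.1 a.2.1 (le_antisymm b.2 a.2.2) c.1
      (le_antisymm c.2 d.2)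
    rfl
  · have a := hA.left_spike
    have c := (hC.resolve_right fun k => by linarith [k.right_spike.1]).right_spike
    have d := (hD.resolve_right fun k => by linarith [k.bottom_spike.1]).bottom_spike
    have b := (hB.resolve_left fun k => by linarith [k.topLeft_spike.1]).topLeft_spike
    rw [Set.pair_comm] at hgh ⊢
    obtain ⟨rfl, rfl⟩ := eq_of_isGuardSet_on_lines hgh a.1 a.2.1 (le_antisymm b.2 a.2.2) c.1
      (le_antisymm c.2 d.2)
    rfl

/-! ### Optimality and irrationality -/

lemma guardL_ne_guardT : guardL ≠ guardT := by
  intro h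
  have h0 : guardL 0 = guardT 0 := by rw [h]
  rw [guardL_zero, guardT_zero] at h0
  linarith [sqrt_two_bounds.1]

lemma not_isGuardSet_singleton (g : Plane) : ¬ IsGuardSet (region gallery) {g} := by
  intro hg
  -- Uniqueness of pairs allows equal guards, so a single guard, read as a degenerate pair, would be
  -- both `guardL` and `guardT`.
  rw [← Set.pair_eq_singleton] at hg
  have h := pair_eq_of_isGuardSet hg
  rw [Set.pair_eq_singleton] at h
  have hL : guardL ∈ ({g} : Set Plane) := h ▸ Set.mem_insert _ _
  have hT : guardT ∈ ({g} : Set Plane) := h ▸ Set.mem_insert_of_mem _ rfl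
  exact guardL_ne_guardT (Eq.trans hL (Eq.symm hT))

lemma two_le_encard_of_isGuardSet {G : Set Plane} (hG : IsGuardSet (region gallery) G) :
    2 ≤ G.encard := by
  by_contra! h
  have h1 : G.encard ≤ 1 := Order.le_of_lt_add_one (by rwa [one_add_one_eq_two])
  rcases Set.encard_le_one_iff_eq.1 h1 with rfl | ⟨g, rfl⟩
  · have : guardL ∈ region gallery := isGuardSet_guardL_guardT.1 (by simp)
    obtain ⟨g, hg, -⟩ := hG.2 _ this
    exact hg
  · exact not_isGuardSet_singleton g hG

lemma isOptimalGuardSet_iff (G : Set Plane) :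
    IsOptimalGuardSet (region gallery) G ↔ G = {guardL, guardT} := by
  have h2 : ({guardL, guardT} : Set Plane).encard = 2 := Set.encard_pair guardL_ne_guardT
  constructor
  · rintro ⟨hG, hmin⟩
    have h := le_antisymm ((hmin _ isGuardSet_guardL_guardT).trans_eq h2)
      (two_le_encard_of_isGuardSet hG)
    obtain ⟨g, h, -, rfl⟩ := Set.encard_eq_two.1 h
    exact pair_eq_of_isGuardSet hG
  · rintro rfl
    exact ⟨isGuardSet_guardL_guardT, fun G' hG' => h2 ▸ two_le_encard_of_isGuardSet hG'⟩

lemma irrational_sub_mul_sqrt_two {a b : ℚ} (hb : b ≠ 0) : Irrational (a - b * √2) :=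
  (irrational_sqrt_two.ratCast_mul hb).ratCast_sub a

lemma irrational_guard_coordinates (k : Fin 2) :
    Irrational (guardL k) ∧ Irrational (guardT k) := by
  have h0 := irrational_sub_mul_sqrt_two (a := 37 / 10) (b := 11 / 5) (by norm_num)
  have h1 := irrational_sub_mul_sqrt_two (a := 117 / 10) (b := 11 / 5) (by norm_num)
  have h2 := irrational_sub_mul_sqrt_two (a := 37 / 5) (b := 1 / 2) (by norm_num)
  have h3 := irrational_sub_mul_sqrt_two (a := 17 / 10) (b := 1 / 2) (by norm_num)
  push_cast at h0 h1 h2 h3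
  fin_cases k
  · exact ⟨h0, h2⟩
  · exact ⟨h1, h3⟩

lemma isRationalPoint_vertices (i : Fin 26) : IsRationalPoint (gallery.vertices i) := by
  intro k
  fin_cases k
  · exact ⟨_, gallery_vertices_zero i⟩
  · exact ⟨_, gallery_vertices_one i⟩

lemma not_isGuardSet_of_isRationalPoint {g h : Plane} (hg : IsRationalPoint g)
    (hh : IsRationalPoint h) : ¬ IsGuardSet (region gallery) {g, h} := by
  intro hgh
  have hL : guardL ∈ ({g, h} : Set Plane) := by
    rw [pair_eq_of_isGuardSet hgh]
    exact Set.mem_insert _ _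
  have key : IsRationalPoint guardL := by
    rcases hL with h' | h'
    · rwa [h']
    · rwa [Set.mem_singleton_iff.1 h']
  obtain ⟨q, hq⟩ := key 0
  exact (irrational_guard_coordinates 0).1 ⟨q, hq.symm⟩

end ArtGallery
open ArtGallery in
theorem theorem1 :
    -- an explicit simple monotone polygon with rational vertices
    (∀ i : Fin 26, IsRationalPoint (gallery.vertices i)) ∧
    IsSimple gallery ∧
    IsMonotone gallery ∧
    -- one guard does not suffice, two guards do
    (∀ g : Plane, ¬ IsGuardSet (region gallery) {g}) ∧
    guardL ≠ guardT ∧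
    IsGuardSet (region gallery) {guardL, guardT} ∧
    -- there is only one way to place two guards
    (∀ g h : Plane, IsGuardSet (region gallery) {g, h} →
      ({g, h} : Set Plane) = {guardL, guardT}) ∧
    (∀ G : Set Plane, IsOptimalGuardSet (region gallery) G ↔ G = {guardL, guardT}) ∧
    -- all coordinates of these two guards are irrational
    (∀ k : Fin 2, Irrational (guardL k) ∧ Irrational (guardT k)) ∧
    -- no two rational guards suffice
    (∀ g h : Plane, IsRationalPoint g → IsRationalPoint h →
      ¬ IsGuardSet (region gallery) {g, h}) :=
  ⟨isRationalPoint_vertices, isSimple_gallery, isMonotone_gallery, not_isGuardSet_singleton,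
    guardL_ne_guardT, isGuardSet_guardL_guardT, fun _ _ => pair_eq_of_isGuardSet,
    isOptimalGuardSet_iff, irrational_guard_coordinates,
    fun _ _ => not_isGuardSet_of_isRationalPoint⟩
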